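/- For complex parameters let $${}_pF_q\biggl[\begin{matrix} a_1,\dots,a_p\\ b_1,\dots,b_q\end{matrix};z\biggr]=\sum_{k=0}^\infty\frac{(a_1)_k\cdots(a_p)_k}{(b_1)_k\cdots(b_q)_k}\,\frac{z^k}{k!},\qquad (a)_k=a(a+1)\cdots(a+k-1),$$ where no $b_i$ is in $\mathbb Z_{\le0}=\{0,-1,-2,\dots\}$ and the sum is the limit of the partial sums. (i) Let $n,c,d\in\mathbb C$ be such that none of the lower parameters of the two series below, nor $4n+3-c-d$, is in $\mathbb Z_{\le0}$, and such that either $\operatorname{Re}(5n+4-2c-2d)>0$ and $\operatorname{Re}(3n+2-c-d)>0$, or at least one of $c,d$ is in $\mathbb Z_{\le0}$ (in which case both series terminate). Then both series converge, and $$ {}_6F_5\biggl[\begin{matrix} 3n+1, \, \frac{3n}2+\frac32, \, n+\frac12, \, n+1, \, c, \, d \\ \frac{3n}2+\frac12, \, 2n+\frac32, \, 2n+1, \, 3n+2-c, \, 3n+2-d \end{matrix}\,; -1\biggr] $$ $$ =\frac{\Gamma(4n+3)\,\Gamma(3n+2-c)\,\Gamma(3n+2-d)\,\Gamma(4n+3-c-d)}{\Gamma(3n+2)\,\Gamma(4n+3-c)\,\Gamma(4n+3-d)\,\Gamma(3n+2-c-d)}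 \;{}_6F_5\biggl[\begin{matrix} 2n+1, \, n+\frac32, \, \frac c2, \, \frac c2+\frac12, \, \frac d2, \, \frac d2+\frac12 \\ n+\frac12, \, 2n+2-\frac c2, \, 2n+\frac32-\frac c2, \, 2n+2-\frac d2, \, 2n+\frac32-\frac d2 \end{matrix}; 1\biggr], $$ where $1/\Gamma$ is read as $0$ at the poles of $\Gamma$. (ii) (The case $c=d=n+\frac12$.) For every integer $n\ge0$, the following two families of approximations to Catalan's constant coincide: both series converge absolutely and $$ \sum_{t=0}^\infty(2t+n+1)\frac{n!\prod_{j=1}^n(t+1-j)\prod_{j=1}^n(t+n+j)}{\prod_{j=0}^n(t+j+\frac12)^3}\,(-1)^{n+t} =2^{2(n+1)}\sum_{t=1}^\infty(2t-1)\frac{(2n+1)!\prod_{j=0}^{2n-1}(t-n+j)}{\prod_{j=0}^{2n+1}(2t-n-\frac32+j)^2}. $$ -/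

import Mathlib

open Filter Topology

noncomputable section

/-- The `k`-th term `(a₁)ₖ ⋯ (aₚ)ₖ / ((b₁)ₖ ⋯ (b_q)ₖ) * z ^ k / k!` of the generalized
hypergeometric series with upper parameters `as`, lower parameters `bs` and argument `z`. -/
def hypTerm (as bs : List ℂ) (z : ℂ) (k : ℕ) : ℂ :=
  (as.map fun a => (ascPochhammer ℂ k).eval a).prod /
    (bs.map fun b => (ascPochhammer ℂ k).eval b).prod * (z ^ k / (k.factorial : ℂ))

/-- The generalized hypergeometric series converges, with sum `s`. Convergence is that of the
partial sums, since on the circle `‖z‖ = 1` it may be conditional. -/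
def HasHypSum (as bs : List ℂ) (z s : ℂ) : Prop :=
  Tendsto (fun N : ℕ => ∑ k ∈ Finset.range N, hypTerm as bs z k) atTop (𝓝 s)

/-- `x` is one of `0, -1, -2, …`. -/
def IsNonposInt (x : ℂ) : Prop :=
  ∃ m : ℕ, x = -(m : ℂ)

/-- The upper parameters of the series at `-1`. -/
def upperL (n c d : ℂ) : List ℂ :=
  [3 * n + 1, 3 * n / 2 + 3 / 2, n + 1 / 2, n + 1, c, d]

/-- The lower parameters of the series at `-1`. -/
def lowerL (n c d : ℂ) : List ℂ :=
  [3 * n / 2 + 1 / 2, 2 * n + 3 / 2, 2 * n + 1, 3 * n + 2 - c, 3 * n + 2 - d]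

/-- The upper parameters of the series at `1`. -/
def upperR (n c d : ℂ) : List ℂ :=
  [2 * n + 1, n + 3 / 2, c / 2, c / 2 + 1 / 2, d / 2, d / 2 + 1 / 2]

/-- The lower parameters of the series at `1`. -/
def lowerR (n c d : ℂ) : List ℂ :=
  [n + 1 / 2, 2 * n + 2 - c / 2, 2 * n + 3 / 2 - c / 2, 2 * n + 2 - d / 2, 2 * n + 3 / 2 - d / 2]

/-- The summand, at `t = 0, 1, 2, …`, of the first family of approximations to Catalan's
constant. -/
def catTerm (n t : ℕ) : ℝ :=
  (2 * t + n + 1) *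
    ((n.factorial * (∏ j ∈ Finset.Icc 1 n, ((t : ℝ) + 1 - j)) *
        ∏ j ∈ Finset.Icc 1 n, ((t : ℝ) + n + j)) /
      ∏ j ∈ Finset.range (n + 1), ((t : ℝ) + j + 1 / 2) ^ 3) * (-1) ^ (n + t)

/-- The summand, at `t = 1, 2, 3, …`, of the second family of approximations to Catalan's constant
(including the factor `2 ^ (2 * (n + 1))` in front of the sum). -/
def catTerm' (n t : ℕ) : ℝ :=
  2 ^ (2 * (n + 1)) *
    ((2 * t - 1) *
      (((2 * n + 1).factorial * ∏ j ∈ Finset.range (2 * n), ((t : ℝ) - n + j)) /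
        ∏ j ∈ Finset.range (2 * n + 2), (2 * (t : ℝ) - n - 3 / 2 + j) ^ 2))

end

/-! Both series are images of one and the same sum under Bailey's lemma. If `(α, β)` is a Bailey
pair relative to `a`, then, subject to convergence, `∑ α_r (c)_r (d)_r / (Γ(1+a-c+r) Γ(1+a-d+r))`
equals `∑ (c)_m (d)_m β_m / Γ(1+a-c-d)`. There are two pairs, relative to `3n+1` and to `4n+2`,
whose second members are both multiples of `betaCore n`. The first (`isBaileyPair_alphaL`) is very
well poised and alternating and gives the series at `-1`. The second (`isBaileyPair_alphaR`) lives
on even indices; with `r = 2k`, the duplication formula for Pochhammer symbols gives the series at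
`1`. Eliminating the common sum leaves the quotient of Gamma functions.

The pairs come from finite identities: Pfaff–Saalschütz (`saalschutz`) gives the finite Bailey lemma
`IsBaileyPair.sum_eq`; applied to the unit pair it yields the very-well-poised pair, and a
recurrence in `m` (`evenSum_telescope`) yields the even one.

The analysis lies in letting `N → ∞` under the stated hypotheses. Dominated convergence works for
`Re (a-c-d) ≥ 0`. Growth bounds uniform in `c` make both sides analytic on a half-plane, and the
identity theorem carries the equality over. At `-1` the series may converge only conditionally;
averaging consecutive terms turns it into an absolutely convergent one.

For Catalan's constant, `c = d = n + 1/2`: both families are, after dropping vanishing terms,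
constant multiples of the two series, and the constants agree by duplication of factorials. -/

/-! ### Pochhammer symbols, reciprocal Gamma, and Pfaff–Saalschütz -/

/-- The Pochhammer symbol `(x)ₖ`. -/
noncomputable def poch (x : ℂ) (k : ℕ) : ℂ := (ascPochhammer ℂ k).eval x

@[simp] lemma poch_zero (x : ℂ) : poch x 0 = 1 := by simp [poch]

lemma poch_succ (x : ℂ) (k : ℕ) : poch x (k + 1) = poch x k * (x + k) := by
  simp [poch, ascPochhammer_succ_eval]

lemma poch_succ_left (x : ℂ) (k : ℕ) : poch x (k + 1) = x * poch (x + 1) k := by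
  simp [poch, ascPochhammer_succ_left, Polynomial.eval_comp]

lemma poch_add (x : ℂ) (m k : ℕ) : poch x (m + k) = poch x m * poch (x + m) k := by
  induction k with
  | zero => simp
  | succ k ih => rw [← add_assoc, poch_succ, ih, poch_succ]; push_cast; ring

lemma prod_range_add_eq_poch (x : ℂ) (m : ℕ) : ∏ j ∈ Finset.range m, (x + j) = poch x m := by
  induction m with
  | zero => simp
  | succ m ih => rw [Finset.prod_range_succ, ih, poch_succ]

lemma inv_Gamma_eq_mul (z : ℂ) :
    (Complex.Gamma z)⁻¹ = z * (Complex.Gamma (z + 1))⁻¹ :=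
  Complex.one_div_Gamma_eq_self_mul_one_div_Gamma_add_one z

lemma inv_Gamma_eq_poch_mul (z : ℂ) (k : ℕ) :
    (Complex.Gamma z)⁻¹ = poch z k * (Complex.Gamma (z + k))⁻¹ := by
  induction k with
  | zero => simp
  | succ k ih =>
    rw [ih, poch_succ, inv_Gamma_eq_mul (z + k), mul_assoc]; push_cast; ring_nf

/-- The Pfaff–Saalschütz summation, cleared of denominators. -/
theorem saalschutz (A B C : ℂ) (n : ℕ) :
    ∑ j ∈ Finset.range (n + 1), (n.choose j : ℂ) * poch A j * poch B j *
        poch (C + j) (n - j) * poch (C - A - B) (n - j) =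
      poch (C - A) n * poch (C - B) n := by
  induction n with
  | zero => simp
  | succ n ih =>
    set D := C - A - B with hD
    -- Telescoping certificate: after Pascal's rule, each summand for `n + 1` is `(C-A+n)(C-B+n)`
    -- times the one for `n`, plus `h (j+1) - h j`. Both ends vanish, by the factor `j` at `0` and
    -- by the binomial at `n + 1`.
    set h : ℕ → ℂ := fun j =>
      (n.choose j : ℂ) * j * poch A j * poch B j * poch (C + j) (n - j) * poch D (n - j + 1) with hh
    have pascal : ∑ j ∈ Finset.range (n + 1 + 1), ((n + 1).choose j : ℂ) * poch A j * poch B j *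
        poch (C + j) (n + 1 - j) * poch D (n + 1 - j) =
        ∑ j ∈ Finset.range (n + 1), (n.choose j : ℂ) * (poch A j * poch B j *
        poch (C + j) (n + 1 - j) * poch D (n + 1 - j) + poch A (j + 1) * poch B (j + 1) *
        poch (C + (j + 1 : ℕ)) (n - j) * poch D (n - j)) := by
      have h1 := Finset.sum_choose_succ_mul (R := ℂ) (fun i k => poch A i * poch B i *
        poch (C + i) k * poch D k) n
      simp only [mul_assoc] at h1 ⊢
      rw [h1, ← Finset.sum_add_distrib]
      refine Finset.sum_congr rfl fun j hj => ?_
      ring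
    have key : ∀ j ∈ Finset.range (n + 1), (n.choose j : ℂ) * (poch A j * poch B j *
        poch (C + j) (n + 1 - j) * poch D (n + 1 - j) + poch A (j + 1) * poch B (j + 1) *
        poch (C + (j + 1 : ℕ)) (n - j) * poch D (n - j)) =
        (C - A + n) * (C - B + n) * ((n.choose j : ℂ) * poch A j * poch B j *
        poch (C + j) (n - j) * poch D (n - j)) + (h (j + 1) - h j) := by
      intro j hj
      obtain ⟨i, rfl⟩ := Nat.exists_eq_add_of_le (Finset.mem_range_succ_iff.mp hj)
      have e1 : j + i + 1 - j = i + 1 := by omega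
      have e2 : j + i - j = i := by omega
      simp only [hh, e1, e2]
      rcases i with _ | i
      · simp [poch_succ, hD]; ring
      · have e3 : j + (i + 1) - (j + 1) = i := by omega
        have hc : ((j + (i + 1)).choose (j + 1) : ℂ) * ((j + 1 : ℕ) : ℂ)
            = ((j + (i + 1)).choose j : ℂ) * (i + 1) := by
          have := Nat.choose_succ_right_eq (j + (i + 1)) j
          have e4 : j + (i + 1) - j = i + 1 := by omega
          rw [e4] at this
          exact_mod_cast this
        rw [e3, hc]
        have p1 : poch (C + j) (i + 1 + 1) = (C + j) * poch (C + (j + 1 : ℕ)) i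
            * (C + j + 1 + i) := by
          rw [poch_succ_left, poch_succ]; push_cast; ring_nf
        have p2 : poch (C + j) (i + 1) = (C + j) * poch (C + (j + 1 : ℕ)) i := by
          rw [poch_succ_left]; push_cast; ring_nf
        have p3 : poch (C + (j + 1 : ℕ)) (i + 1) = poch (C + (j + 1 : ℕ)) i
            * (C + j + 1 + i) := by
          rw [poch_succ]; push_cast; ring_nf
        rw [p1, p2, p3, poch_succ A, poch_succ B, poch_succ D (i + 1)]
        push_cast
        rw [hD]; ring
    rw [pascal, Finset.sum_congr rfl key, Finset.sum_add_distrib, ← Finset.mul_sum, ih,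
      Finset.sum_range_sub]
    simp [hh, poch_succ]
    ring

/-! ### Bailey pairs and the finite Bailey lemma -/

/-- `(α, β)` is a Bailey pair relative to `a`, normalised with `1 / Γ` so that `1 + a` may be a
pole of `Γ`. -/
def IsBaileyPair (a : ℂ) (α β : ℕ → ℂ) : Prop :=
  ∀ m, β m = ∑ r ∈ Finset.range (m + 1),
    α r / ((m - r).factorial : ℂ) * (Complex.Gamma (1 + a + m + r))⁻¹

/-- Finite Bailey lemma: insert the definition of `β` and exchange the sums; the inner sum is
Saalschütz with parameters `c + r`, `d + r`, `1 + a + 2r`. -/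
theorem IsBaileyPair.sum_eq {a : ℂ} {α β : ℕ → ℂ} (h : IsBaileyPair a α β) (c d : ℂ) (N : ℕ) :
    ∑ m ∈ Finset.range (N + 1), poch c m * poch d m *
        (poch (1 + a - c - d) (N - m) / ((N - m).factorial : ℂ)) * β m =
      ∑ r ∈ Finset.range (N + 1), α r * poch c r * poch d r * poch (1 + a - c + r) (N - r) *
        poch (1 + a - d + r) (N - r) / ((N - r).factorial : ℂ) *
        (Complex.Gamma (1 + a + N + r))⁻¹ := by
  simp only [h _, Finset.mul_sum]
  rw [Finset.sum_comm' (t' := Finset.range (N + 1)) (s' := fun r => Finset.Ico r (N + 1))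
    (by intro x y; simp only [Finset.mem_range, Finset.mem_Ico]; omega)]
  refine Finset.sum_congr rfl fun r hr => ?_
  obtain ⟨i, rfl⟩ := Nat.exists_eq_add_of_le (Finset.mem_range_succ_iff.mp hr)
  rw [Finset.sum_Ico_eq_sum_range]
  have e1 : r + i + 1 - r = i + 1 := by omega
  have e2 : r + i - r = i := by omega
  rw [e1, e2]
  have hs := saalschutz (c + r) (d + r) (1 + a + 2 * r) i
  have q1 : (1 : ℂ) + a + 2 * r - (c + r) = 1 + a - c + r := by ring
  have q2 : (1 : ℂ) + a + 2 * r - (d + r) = 1 + a - d + r := by ring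
  have q3 : (1 : ℂ) + a - c + r - (d + r) = 1 + a - c - d := by ring
  rw [q1, q2, q3] at hs
  rw [mul_assoc (α r * poch c r * poch d r), ← hs, Finset.mul_sum, Finset.sum_div, Finset.sum_mul]
  refine Finset.sum_congr rfl fun j hj => ?_
  obtain ⟨l, rfl⟩ := Nat.exists_eq_add_of_le (Finset.mem_range_succ_iff.mp hj)
  have e3 : r + (j + l) - (r + j) = l := by omega
  have e4 : r + j - r = j := by omega
  have e5 : j + l - j = l := by omega
  rw [e3, e4, e5, poch_add c, poch_add d,
    inv_Gamma_eq_poch_mul (1 + a + (r + j : ℕ) + r) l, Nat.cast_choose ℂ (Nat.le_add_right j l), e5]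
  have q4 : (1 : ℂ) + a + (r + j : ℕ) + r = 1 + a + 2 * r + j := by push_cast; ring
  have q5 : (1 : ℂ) + a + 2 * r + j + l = 1 + a + (r + (j + l) : ℕ) + r := by push_cast; ring
  rw [q4, q5]
  have f1 : (j.factorial : ℂ) ≠ 0 := by exact_mod_cast j.factorial_ne_zero
  have f2 : (l.factorial : ℂ) ≠ 0 := by exact_mod_cast l.factorial_ne_zero
  have f3 : ((j + l).factorial : ℂ) ≠ 0 := by exact_mod_cast (j + l).factorial_ne_zero
  field_simp

/-- The unit Bailey pair. -/
theorem isBaileyPair_unit (a : ℂ) :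
    IsBaileyPair a (fun r => (-1) ^ r * (a + 2 * r) * poch a r / (r.factorial : ℂ))
      (fun m => if m = 0 then a * (Complex.Gamma (1 + a))⁻¹ else 0) := by
  rintro (_ | m)
  · simp
  -- The partial sums have a closed form; its value at `k = m + 1` cancels the last term of the full
  -- sum.
  have key : ∀ k, k ≤ m + 1 → ∑ r ∈ Finset.range k, ((m + 1).choose r : ℂ) *
      ((-1) ^ r * (a + 2 * r) * poch a r) * (Complex.Gamma (1 + a + (m + 1 : ℕ) + r))⁻¹ =
      -((-1) ^ k * (k * (m + 1).choose k / (m + 1)) * poch a k *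
        (Complex.Gamma (a + (m + 1 : ℕ) + k))⁻¹) := by
    intro k hk
    induction k with
    | zero => simp
    | succ k ih =>
      rw [Finset.sum_range_succ, ih (by omega), inv_Gamma_eq_mul (a + (m + 1 : ℕ) + k), poch_succ]
      have hc : (((k + 1 : ℕ) : ℂ) * (m + 1).choose (k + 1)) =
          ((m + 1).choose k : ℂ) * (m + 1 - k) := by
        have h1 := Nat.choose_succ_right_eq (m + 1) k
        have h2 : ((m + 1 - k : ℕ) : ℂ) = (m : ℂ) + 1 - k := by
          rw [Nat.cast_sub (by omega)]; push_cast; ring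
        rw [← h2, mul_comm]; exact_mod_cast h1
      rw [hc]
      have g1 : a + (m + 1 : ℕ) + k + 1 = 1 + a + (m + 1 : ℕ) + k := by ring
      have g2 : a + (m + 1 : ℕ) + (k + 1 : ℕ) = 1 + a + (m + 1 : ℕ) + k := by push_cast; ring
      rw [g1, g2]
      have hm : (m : ℂ) + 1 ≠ 0 := by exact_mod_cast Nat.succ_ne_zero m
      field_simp
      push_cast
      ring
  have h2 : ∑ r ∈ Finset.range (m + 1 + 1), ((m + 1).choose r : ℂ) *
      ((-1) ^ r * (a + 2 * r) * poch a r) * (Complex.Gamma (1 + a + (m + 1 : ℕ) + r))⁻¹ = 0 := by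
    rw [Finset.sum_range_succ, key _ le_rfl]
    rw [inv_Gamma_eq_mul (a + (m + 1 : ℕ) + (m + 1 : ℕ))]
    have hm : (m : ℂ) + 1 ≠ 0 := by exact_mod_cast Nat.succ_ne_zero m
    have g1 : a + (m + 1 : ℕ) + (m + 1 : ℕ) + 1 = 1 + a + (m + 1 : ℕ) + (m + 1 : ℕ) := by ring
    rw [g1]
    simp
    field_simp
    ring
  simp only [Nat.succ_ne_zero, if_false]
  have f : ((m + 1).factorial : ℂ) ≠ 0 := by exact_mod_cast (m + 1).factorial_ne_zero
  rw [← mul_right_inj' f, mul_zero, ← h2, Finset.mul_sum]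
  refine Finset.sum_congr rfl fun r hr => ?_
  rw [Nat.cast_choose ℂ (Finset.mem_range_succ_iff.mp hr)]
  have f1 : (r.factorial : ℂ) ≠ 0 := by exact_mod_cast r.factorial_ne_zero
  have f2 : ((m + 1 - r).factorial : ℂ) ≠ 0 := by exact_mod_cast (m + 1 - r).factorial_ne_zero
  field_simp

/-- One step along the Bailey chain: in the finite Bailey lemma for the unit pair only `m = 0`
survives on the `β` side, and division by `(1+a-b)_m (1+a-b')_m` turns the identity into the
defining relation of a new pair. -/
theorem isBaileyPair_veryWellPoised (a b b' : ℂ) (hb : ∀ k, poch (1 + a - b) k ≠ 0)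
    (hb' : ∀ k, poch (1 + a - b') k ≠ 0) :
    IsBaileyPair a
      (fun r => (-1) ^ r * ((a + 2 * r) * (poch a r / (r.factorial : ℂ)) *
        (poch b r / poch (1 + a - b) r) * (poch b' r / poch (1 + a - b') r)))
      (fun m => a * (Complex.Gamma (1 + a))⁻¹ * (poch (1 + a - b - b') m /
        (poch (1 + a - b) m * poch (1 + a - b') m * (m.factorial : ℂ)))) := by
  intro m
  have h := (isBaileyPair_unit a).sum_eq b b' m
  rw [Finset.sum_eq_single 0 (by intro k _ hk; simp [hk]) (by simp)] at h
  simp only [poch_zero, if_true, Nat.sub_zero] at h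
  have e : a * (Complex.Gamma (1 + a))⁻¹ * (poch (1 + a - b - b') m /
        (poch (1 + a - b) m * poch (1 + a - b') m * (m.factorial : ℂ))) =
      (1 * 1 * (poch (1 + a - b - b') m / (m.factorial : ℂ)) * (a * (Complex.Gamma (1 + a))⁻¹)) /
        (poch (1 + a - b) m * poch (1 + a - b') m) := by
    have := hb m; have := hb' m
    field_simp
  simp only [e]
  rw [h, Finset.sum_div]
  refine Finset.sum_congr rfl fun r hr => ?_
  obtain ⟨i, rfl⟩ := Nat.exists_eq_add_of_le (Finset.mem_range_succ_iff.mp hr)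
  have e2 : r + i - r = i := by omega
  have h1 := hb (r + i)
  have h2 := hb' (r + i)
  rw [poch_add] at h1 h2
  rw [e2, poch_add (1 + a - b), poch_add (1 + a - b')]
  have h3 := left_ne_zero_of_mul h1
  have h4 := right_ne_zero_of_mul h1
  have h5 := left_ne_zero_of_mul h2
  have h6 := right_ne_zero_of_mul h2
  have f1 : (r.factorial : ℂ) ≠ 0 := by exact_mod_cast r.factorial_ne_zero
  have f2 : (i.factorial : ℂ) ≠ 0 := by exact_mod_cast i.factorial_ne_zero
  field_simp

/-! ### The Bailey pair supported on even indices -/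

lemma cast_descFactorial_succ (m k : ℕ) :
    (m.descFactorial (k + 1) : ℂ) = (m - k) * m.descFactorial k := by
  rcases le_or_gt k m with h | h
  · rw [Nat.descFactorial_succ, Nat.cast_mul, Nat.cast_sub h]
  · rw [Nat.descFactorial_of_lt h, Nat.descFactorial_of_lt (by omega)]; simp

/-- The sum behind the Bailey pair supported on even indices, with an arbitrary upper limit. -/
noncomputable def evenSum (x : ℂ) (m K : ℕ) : ℂ :=
  ∑ k ∈ Finset.range K, (x + 2 * k) * poch x k / (k.factorial : ℂ) * m.descFactorial (2 * k) *
    (Complex.Gamma (1 + 2 * x + m + 2 * k))⁻¹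

/-- A creative-telescoping recurrence in `m`. The boundary term on the right vanishes once `2K - 1 >
m`, leaving a first-order recurrence for the complete sum. -/
lemma evenSum_telescope (x : ℂ) (m K : ℕ) :
    (2 * x + 2 * m) * (2 * x + 2 * m + 1) * evenSum x (m + 1) K - (2 * x + 4 * m) * evenSum x m K =
      -2 * (x + 2 * K - 1) * K * (poch x K / (K.factorial : ℂ)) * m.descFactorial (2 * K - 1) *
        (Complex.Gamma (2 * x + m + 2 * K))⁻¹ := by
  induction K with
  | zero => simp [evenSum]
  | succ K ih =>
    have hs : ∀ M, evenSum x M (K + 1) = evenSum x M K +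
        (x + 2 * K) * poch x K / (K.factorial : ℂ) * M.descFactorial (2 * K) *
    (Complex.Gamma (1 + 2 * x + M + 2 * K))⁻¹ := fun M => Finset.sum_range_succ _ _
    rw [hs, hs]
    have ih' : (2 * x + 2 * m) * (2 * x + 2 * m + 1) * evenSum x (m + 1) K =
      (2 * x + 4 * m) * evenSum x m K +
      -2 * (x + 2 * K - 1) * K * (poch x K / (K.factorial : ℂ)) * m.descFactorial (2 * K - 1) *
        (Complex.Gamma (2 * x + m + 2 * K))⁻¹ := by rw [← ih]; ring
    rw [mul_add, ih']
    have g1 : 1 + 2 * x + (m + 1 : ℕ) + 2 * K = 2 * x + m + 2 * (K + 1 : ℕ) := by push_cast; ring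
    have g2 : 1 + 2 * x + m + 2 * K + 1 = 2 * x + m + 2 * (K + 1 : ℕ) := by push_cast; ring
    have g3 : 2 * x + m + 2 * K + 1 = 1 + 2 * x + m + 2 * K := by ring
    rw [inv_Gamma_eq_mul (2 * x + m + 2 * K), g3, inv_Gamma_eq_mul (1 + 2 * x + m + 2 * K), g1, g2,
      poch_succ, Nat.factorial_succ]
    set g := (Complex.Gamma (2 * x + m + 2 * (K + 1 : ℕ)))⁻¹
    have f1 : (K.factorial : ℂ) ≠ 0 := by exact_mod_cast K.factorial_ne_zero
    have f2 : (K : ℂ) + 1 ≠ 0 := by exact_mod_cast Nat.succ_ne_zero K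
    have e1 : 2 * (K + 1) - 1 = 2 * K + 1 := by omega
    rw [e1]
    -- At `K = 0` the truncated `2K - 1` is `0`; the factor `K` makes that boundary term vanish
    -- anyway.
    rcases K with _ | K
    · simp
      ring
    · have e2 : 2 * (K + 1) - 1 = 2 * K + 1 := by omega
      have e3 : 2 * (K + 1) = 2 * K + 1 + 1 := by omega
      rw [e2, e3, cast_descFactorial_succ m (2 * K + 1 + 1), cast_descFactorial_succ m (2 * K + 1),
        Nat.succ_descFactorial_succ]
      push_cast at f2 ⊢
      field_simp
      ring

lemma evenSum_eq (x : ℂ) (hx : ∀ k : ℕ, 2 * x + k ≠ 0) (m K : ℕ) (hK : m < K) :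
    evenSum x m K = x * (Complex.Gamma (1 + 2 * x))⁻¹ *
      (poch (x / 2) m / (poch x m * poch (x + 1 / 2) m)) := by
  induction m with
  | zero =>
    obtain ⟨K, rfl⟩ := Nat.exists_eq_succ_of_ne_zero (by omega : K ≠ 0)
    rw [evenSum, Finset.sum_range_succ', Finset.sum_eq_zero]
    · simp
    · intro k _
      simp [Nat.descFactorial_of_lt (show 0 < 2 * (k + 1) by omega)]
  | succ m ih =>
    have h := evenSum_telescope x m K
    rw [ih (by omega), Nat.descFactorial_of_lt (show m < 2 * K - 1 by omega)] at h
    have h0 : 2 * x + 2 * m ≠ 0 := by simpa using hx (2 * m)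
    have h1 : 2 * x + 2 * m + 1 ≠ 0 := by simpa [add_assoc] using hx (2 * m + 1)
    have h2 : (2 * x + 2 * m) * (2 * x + 2 * m + 1) ≠ 0 := mul_ne_zero h0 h1
    have h3 : x + m ≠ 0 := fun h => h0 (by linear_combination 2 * h)
    have h4 : x + 1 / 2 + m ≠ 0 := fun h => h1 (by linear_combination 2 * h)
    rw [← mul_right_inj' h2]
    rw [sub_eq_iff_eq_add] at h
    rw [h, poch_succ, poch_succ, poch_succ,
      show (poch x m * (x + m) * (poch (x + 1 / 2) m * (x + 1 / 2 + m))) =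
        (poch x m * poch (x + 1 / 2) m) * ((x + m) * (x + 1 / 2 + m)) by ring,
      mul_div_mul_comm]
    have hr : (2 * x + 2 * m) * (2 * x + 2 * m + 1) *
        ((x / 2 + m) / ((x + m) * (x + 1 / 2 + m))) = 2 * x + 4 * m := by
      rw [← mul_div_assoc, div_eq_iff (mul_ne_zero h3 h4)]; ring
    rw [Nat.cast_zero]
    linear_combination (-(x * (Complex.Gamma (1 + 2 * x))⁻¹ *
      (poch (x / 2) m / (poch x m * poch (x + 1 / 2) m)))) * hr

/-- A Bailey pair relative to `2 x` whose first member is supported on the even integers. -/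
theorem isBaileyPair_even (x : ℂ) (hx : ∀ k : ℕ, 2 * x + k ≠ 0) :
    IsBaileyPair (2 * x)
      (fun r => if Even r then (x + r) * (poch x (r / 2) / ((r / 2).factorial : ℂ)) else 0)
      (fun m => x * (Complex.Gamma (1 + 2 * x))⁻¹ *
        (poch (x / 2) m / (poch x m * poch (x + 1 / 2) m * (m.factorial : ℂ)))) := by
  intro m
  have f : (m.factorial : ℂ) ≠ 0 := by exact_mod_cast m.factorial_ne_zero
  have split : ∀ (F : ℕ → ℂ) (K : ℕ), ∑ r ∈ Finset.range (2 * K), (if Even r then F r else 0) =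
      ∑ k ∈ Finset.range K, F (2 * k) := by
    intro F K
    induction K with
    | zero => simp
    | succ K ih =>
      rw [show 2 * (K + 1) = 2 * K + 1 + 1 by ring, Finset.sum_range_succ, Finset.sum_range_succ,
        Finset.sum_range_succ, ih]
      simp
  have h : ∑ r ∈ Finset.range (m + 1), (m.factorial : ℂ) *
      ((if Even r then (x + r) * (poch x (r / 2) / ((r / 2).factorial : ℂ)) else 0) /
        ((m - r).factorial : ℂ) * (Complex.Gamma (1 + 2 * x + m + r))⁻¹) =
      evenSum x m (m + 1) := by
    rw [evenSum]
    -- `m! / (m-r)!` is `m.descFactorial r`, zero for `r > m`, so the range can be lengthened to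
    -- `2(m+1)` and split by parity.
    have := split (fun r => (x + r) * (poch x (r / 2) / ((r / 2).factorial : ℂ)) *
      m.descFactorial r * (Complex.Gamma (1 + 2 * x + m + r))⁻¹) (m + 1)
    have r1 : Finset.range (m + 1) ⊆ Finset.range (2 * (m + 1)) := by
      apply Finset.range_subset_range.mpr; omega
    rw [← Finset.sum_subset r1] at this
    · convert this using 2 with r hr k hk
      · split_ifs
        · rw [← Nat.factorial_mul_descFactorial (Finset.mem_range_succ_iff.mp hr)]
          have f2 : ((m - r).factorial : ℂ) ≠ 0 := by exact_mod_cast (m - r).factorial_ne_zero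
          push_cast
          field_simp
        · simp
      · have e : 2 * k / 2 = k := by omega
        rw [e]; push_cast; ring
    · intro r _ hr
      simp only [Finset.mem_range, not_lt] at hr
      simp [Nat.descFactorial_of_lt (show m < r by omega)]
  rw [← mul_right_inj' f, Finset.mul_sum, h, evenSum_eq x hx m _ (Nat.lt_succ_self m)]
  field_simp

/-! ### The limit `N → ∞` in the finite Bailey lemma -/

lemma tendsto_inv_Gamma_asymp_of_re_pos (z : ℂ) (hz : 0 < z.re) :
    Tendsto (fun N : ℕ => (N.factorial : ℂ) * (N : ℂ) ^ z * (Complex.Gamma (z + 1 + N))⁻¹)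
      atTop (𝓝 1) := by
  have h := (Complex.GammaSeq_tendsto_Gamma z).mul_const (Complex.Gamma z)⁻¹
  have h0 : Complex.Gamma z ≠ 0 := Complex.Gamma_ne_zero_of_re_pos hz
  rw [mul_inv_cancel₀ h0] at h
  refine h.congr fun N => ?_
  have hp := prod_range_add_eq_poch z (N + 1)
  have hne : poch z (N + 1) ≠ 0 := by
    rw [← hp, Finset.prod_ne_zero_iff]
    intro j _ hj
    have := congrArg Complex.re hj
    simp at this
    have : (0 : ℝ) ≤ j := Nat.cast_nonneg j
    linarith
  have e : z + 1 + N = z + (N + 1 : ℕ) := by push_cast; ring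
  rw [Complex.GammaSeq, hp, inv_Gamma_eq_poch_mul z (N + 1), e]
  field_simp

/-- Euler's limit settles the right half-plane; the functional equation of `1/Γ` moves leftwards one
unit at a time. -/
lemma tendsto_inv_Gamma_asymp (z : ℂ) :
    Tendsto (fun N : ℕ => (N.factorial : ℂ) * (N : ℂ) ^ (z - 1) * (Complex.Gamma (z + N))⁻¹)
      atTop (𝓝 1) := by
  have key : ∀ (k : ℕ) (z : ℂ), 1 < z.re + k →
      Tendsto (fun N : ℕ => (N.factorial : ℂ) * (N : ℂ) ^ (z - 1) * (Complex.Gamma (z + N))⁻¹)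
      atTop (𝓝 1) := by
    intro k
    induction k with
    | zero =>
      intro z hz
      have := tendsto_inv_Gamma_asymp_of_re_pos (z - 1) (by simp at hz ⊢; linarith)
      simpa using this
    | succ k ih =>
      intro z hz
      have h1 := ih (z + 1) (by push_cast at hz; simp; linarith)
      have h2 : Tendsto (fun N : ℕ => (z + N) / (N : ℂ)) atTop (𝓝 1) := by
        have h3 : Tendsto (fun N : ℕ => z / (N : ℂ) + 1) atTop (𝓝 (0 + 1)) :=
          (tendsto_const_div_atTop_nhds_zero_nat z).add_const 1
        rw [zero_add] at h3
        refine h3.congr' ?_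
        filter_upwards [eventually_ge_atTop 1] with N hN
        have : (N : ℂ) ≠ 0 := by exact_mod_cast (by omega : N ≠ 0)
        field_simp
      have h4 := h1.mul h2
      rw [one_mul] at h4
      refine h4.congr' ?_
      filter_upwards [eventually_ge_atTop 1] with N hN
      have hN0 : (N : ℂ) ≠ 0 := by exact_mod_cast (by omega : N ≠ 0)
      rw [inv_Gamma_eq_mul (z + N), add_sub_cancel_right, Complex.cpow_sub _ _ hN0,
        Complex.cpow_one, show z + 1 + (N : ℂ) = z + N + 1 by ring]
      field_simp
  obtain ⟨k, hk⟩ := exists_nat_gt (1 - z.re)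
  exact key k z (by linarith)

lemma eventually_Gamma_ne_zero (z : ℂ) : ∀ᶠ N : ℕ in atTop, Complex.Gamma (z + N) ≠ 0 := by
  obtain ⟨k, hk⟩ := exists_nat_gt (-z.re)
  filter_upwards [eventually_ge_atTop k] with N hN
  apply Complex.Gamma_ne_zero_of_re_pos
  have : (k : ℝ) ≤ N := by exact_mod_cast hN
  simp; linarith

/-- The powers of `N` cancel, since the two arguments in the numerator and the two in the
denominator have the same sum. -/
lemma tendsto_Gamma_quotient (a c d : ℂ) :
    Tendsto (fun N : ℕ => Complex.Gamma (1 + a - c + N) * Complex.Gamma (1 + a - d + N) *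
      (Complex.Gamma (1 + a - c - d + N))⁻¹ * (Complex.Gamma (1 + a + N))⁻¹) atTop (𝓝 1) := by
  have h := ((tendsto_inv_Gamma_asymp (1 + a - c - d)).mul
    (tendsto_inv_Gamma_asymp (1 + a))).div ((tendsto_inv_Gamma_asymp (1 + a - c)).mul
    (tendsto_inv_Gamma_asymp (1 + a - d))) (by simp)
  simp only [mul_one, div_one] at h
  refine h.congr' ?_
  filter_upwards [eventually_ge_atTop 1, eventually_Gamma_ne_zero (1 + a - c),
    eventually_Gamma_ne_zero (1 + a - d)] with N hN h1 h2
  have hN0 : (N : ℂ) ≠ 0 := by exact_mod_cast (by omega : N ≠ 0)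
  have f : (N.factorial : ℂ) ≠ 0 := by exact_mod_cast N.factorial_ne_zero
  have p1 : (N : ℂ) ^ (1 + a - c - 1) ≠ 0 := by simp [Complex.cpow_eq_zero_iff, hN0]
  have p2 : (N : ℂ) ^ (1 + a - d - 1) ≠ 0 := by simp [Complex.cpow_eq_zero_iff, hN0]
  have p : (N : ℂ) ^ (1 + a - c - d - 1) * (N : ℂ) ^ (1 + a - 1) =
      (N : ℂ) ^ (1 + a - c - 1) * (N : ℂ) ^ (1 + a - d - 1) := by
    rw [← Complex.cpow_add _ _ hN0, ← Complex.cpow_add _ _ hN0]; congr 1; ring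
  simp only [Pi.div_apply]
  rw [show ∀ A B D E F : ℂ, A * B * E * (A * D * F) = A * A * (B * D) * E * F by intros; ring, p]
  field_simp

/-- The weights `∏ (N - i) / (N - i + z)` of the finite Bailey lemma. -/
noncomputable def saalWeight (z : ℂ) (N m : ℕ) : ℂ :=
  ∏ i ∈ Finset.range m, ((N : ℂ) - i) / (N - i + z)

/-- The weights `∏ (N - i) / (N + z + i)` of the finite Bailey lemma. -/
noncomputable def poisedWeight (z : ℂ) (N r : ℕ) : ℂ :=
  ∏ i ∈ Finset.range r, ((N : ℂ) - i) / (N + z + i)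

lemma tendsto_linear_quotient (u v : ℂ) :
    Tendsto (fun N : ℕ => ((N : ℂ) + u) / (N + v)) atTop (𝓝 1) := by
  have h1 : ∀ u : ℂ, Tendsto (fun N : ℕ => 1 + u / (N : ℂ)) atTop (𝓝 (1 + 0)) := fun u =>
    (tendsto_const_div_atTop_nhds_zero_nat u).const_add 1
  have h2 := (h1 u).div (h1 v) (by simp)
  simp only [add_zero, div_one] at h2
  refine h2.congr' ?_
  filter_upwards [eventually_ge_atTop 1] with N hN
  have hN0 : (N : ℂ) ≠ 0 := by exact_mod_cast (by omega : N ≠ 0)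
  simp only [Pi.div_apply]
  rw [one_add_div hN0, one_add_div hN0, div_div_div_cancel_right₀ hN0]

lemma tendsto_saalWeight (z : ℂ) (m : ℕ) :
    Tendsto (fun N => saalWeight z N m) atTop (𝓝 1) := by
  rw [← Finset.prod_const_one (s := Finset.range m)]
  refine tendsto_finsetProd _ fun i _ => ?_
  simpa [sub_eq_add_neg, add_assoc] using tendsto_linear_quotient (-i) (-i + z)

lemma tendsto_poisedWeight (z : ℂ) (m : ℕ) :
    Tendsto (fun N => poisedWeight z N m) atTop (𝓝 1) := by
  rw [← Finset.prod_const_one (s := Finset.range m)]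
  refine tendsto_finsetProd _ fun i _ => ?_
  simpa [sub_eq_add_neg, add_assoc] using tendsto_linear_quotient (-i) (z + i)

lemma saalWeight_eq_zero (z : ℂ) {N m : ℕ} (h : N < m) : saalWeight z N m = 0 :=
  Finset.prod_eq_zero (Finset.mem_range.mpr h) (by simp)

lemma poisedWeight_eq_zero (z : ℂ) {N m : ℕ} (h : N < m) : poisedWeight z N m = 0 :=
  Finset.prod_eq_zero (Finset.mem_range.mpr h) (by simp)

/-- For `i ≤ N` and `Re z ≥ 0` each denominator has modulus at least `N - i`. This bound is the
source of the restriction `Re (a-c-d) ≥ 0` in the first form of Bailey's lemma. -/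
lemma norm_saalWeight_le {z : ℂ} (hz : 0 ≤ z.re) (N m : ℕ) : ‖saalWeight z N m‖ ≤ 1 := by
  rcases lt_or_ge N m with h | h
  · simp [saalWeight_eq_zero z h]
  rw [saalWeight, norm_prod]
  refine Finset.prod_le_one (fun _ _ => norm_nonneg _) fun i hi => ?_
  have hi' : i ≤ N := (Finset.mem_range.mp hi).le.trans h
  rw [norm_div]
  refine div_le_one_of_le₀ ?_ (norm_nonneg _)
  have h1 : ((N : ℂ) - i) = ((N - i : ℕ) : ℂ) := by rw [Nat.cast_sub hi']
  rw [h1, Complex.norm_natCast]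
  refine le_trans ?_ (Complex.re_le_norm _)
  simp [hz]

lemma norm_poisedWeight_le (z : ℂ) :
    ∃ C, ∀ᶠ N : ℕ in atTop, ∀ m, ‖poisedWeight z N m‖ ≤ C := by
  obtain ⟨K, hK⟩ := exists_nat_ge ‖z‖
  -- With `K ≥ ‖z‖` only the factors `i < K` can exceed `1`, and for `N > 2K` they are at most `2`.
  refine ⟨2 ^ K, ?_⟩
  filter_upwards [eventually_ge_atTop (2 * K + 1)] with N hN m
  rcases lt_or_ge N m with h | h
  · simp [poisedWeight_eq_zero z h]
  rw [poisedWeight, norm_prod]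
  have hNK : (2 : ℝ) * K + 1 ≤ N := by exact_mod_cast hN
  have hK0 : (0 : ℝ) ≤ K := Nat.cast_nonneg K
  calc ∏ i ∈ Finset.range m, ‖((N : ℂ) - i) / (N + z + i)‖
      ≤ ∏ i ∈ Finset.range m, (if i ∈ Finset.range K then (2 : ℝ) else 1) := by
        refine Finset.prod_le_prod (fun _ _ => norm_nonneg _) fun i hi => ?_
        have hi' : i ≤ N := (Finset.mem_range.mp hi).le.trans h
        have h1 : ((N : ℂ) - i) = ((N - i : ℕ) : ℂ) := by rw [Nat.cast_sub hi']
        have h2 : (N : ℝ) + i - K ≤ ‖(N : ℂ) + z + i‖ := by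
          have h3 := norm_sub_norm_le ((N + i : ℕ) : ℂ) (-z)
          rw [Complex.norm_natCast, norm_neg] at h3
          have e : ((N + i : ℕ) : ℂ) - -z = N + z + i := by push_cast; ring
          rw [e] at h3
          push_cast at h3
          linarith
        have hi0 : (0 : ℝ) ≤ i := Nat.cast_nonneg i
        rw [norm_div, h1, Complex.norm_natCast, Nat.cast_sub hi']
        rw [div_le_iff₀ (by linarith)]
        split_ifs with hiK
        · linarith
        · have : (K : ℝ) ≤ i := by exact_mod_cast (not_lt.mp (by simpa using hiK))
          linarith
    _ ≤ 2 ^ K := by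
        rw [Finset.prod_ite, Finset.prod_const_one, mul_one, Finset.prod_const]
        refine pow_le_pow_right₀ (by norm_num) ?_
        refine (Finset.card_le_card (t := Finset.range K) ?_).trans (by simp)
        intro i hi
        exact (Finset.mem_filter.mp hi).2

lemma poch_div_factorial_eq_saalWeight {z : ℂ} (hz : 0 ≤ z.re) {N m : ℕ} (h : m ≤ N) :
    poch (1 + z) (N - m) / ((N - m).factorial : ℂ) * N.factorial *
      (Complex.Gamma (1 + z + N))⁻¹ = (Complex.Gamma (1 + z))⁻¹ * saalWeight z N m := by
  induction m with
  | zero =>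
    have f : (N.factorial : ℂ) ≠ 0 := by exact_mod_cast N.factorial_ne_zero
    rw [inv_Gamma_eq_poch_mul (1 + z) N]
    rw [saalWeight, Finset.prod_range_zero, mul_one, Nat.sub_zero, div_mul_cancel₀ _ f]
  | succ m ih =>
    obtain ⟨i, rfl⟩ := Nat.exists_eq_add_of_le h
    have e1 : m + 1 + i - (m + 1) = i := by omega
    have e2 : m + 1 + i - m = i + 1 := by omega
    have ih' := ih (by omega)
    rw [saalWeight, Finset.prod_range_succ, ← saalWeight, ← mul_assoc, ← ih', e1, e2, poch_succ,
      Nat.factorial_succ]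
    have f : (i.factorial : ℂ) ≠ 0 := by exact_mod_cast i.factorial_ne_zero
    have f2 : (i : ℂ) + 1 ≠ 0 := by exact_mod_cast Nat.succ_ne_zero i
    have hne : 1 + z + i ≠ 0 := by
      intro h0
      have := congrArg Complex.re h0
      simp at this
      have : (0 : ℝ) ≤ i := Nat.cast_nonneg i
      linarith
    have e3 : (((m + 1 + i : ℕ) : ℂ) - m + z) = 1 + z + i := by push_cast; ring
    have e4 : (((m + 1 + i : ℕ) : ℂ) - m) = i + 1 := by push_cast; ring
    rw [e3, e4, Nat.cast_mul]
    push_cast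
    field_simp

lemma poisedWeight_eq (z : ℂ) {N r : ℕ} (h : r ≤ N) :
    poisedWeight z N r =
      (N.factorial : ℂ) / ((N - r).factorial : ℂ) / poch (N + z) r := by
  induction r with
  | zero =>
    have f : (N.factorial : ℂ) ≠ 0 := by exact_mod_cast N.factorial_ne_zero
    simp [poisedWeight, f]
  | succ m ih =>
    obtain ⟨i, rfl⟩ := Nat.exists_eq_add_of_le h
    have e1 : m + 1 + i - (m + 1) = i := by omega
    have e2 : m + 1 + i - m = i + 1 := by omega
    have ih' := ih (by omega)
    rw [poisedWeight, Finset.prod_range_succ, ← poisedWeight, ih', e1, e2, poch_succ,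
      Nat.factorial_succ i]
    have f : (i.factorial : ℂ) ≠ 0 := by exact_mod_cast i.factorial_ne_zero
    have f2 : (i : ℂ) + 1 ≠ 0 := by exact_mod_cast Nat.succ_ne_zero i
    have e4 : (((m + 1 + i : ℕ) : ℂ) - m) = i + 1 := by push_cast; ring
    rw [e4]
    push_cast
    -- The Pochhammer factors may vanish, so their inverses are kept as opaque atoms.
    simp only [div_eq_mul_inv, mul_inv]
    generalize (poch ((m : ℂ) + 1 + i + z) m)⁻¹ = p
    generalize ((m : ℂ) + 1 + i + z + m)⁻¹ = q
    field_simp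

/-- The factor `(c)ₖ / Γ(e - c + k)` of a well-poised series. -/
noncomputable def poised (e c : ℂ) (k : ℕ) : ℂ := poch c k * (Complex.Gamma (e - c + k))⁻¹

/-- Bailey's lemma, in the region where all series converge well. -/
theorem IsBaileyPair.tsum_eq_of_re_nonneg {a : ℂ} {α β : ℕ → ℂ} (h : IsBaileyPair a α β)
    {c d : ℂ} (hre : 0 ≤ (a - c - d).re)
    (hβ : Summable fun m => poch c m * poch d m * β m)
    (hα : Summable fun r => α r * (poised (1 + a) c r * poised (1 + a) d r)) :
    ∑' r, α r * (poised (1 + a) c r * poised (1 + a) d r) =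
      (Complex.Gamma (1 + a - c - d))⁻¹ * ∑' m, poch c m * poch d m * β m := by
  set G : ℕ → ℂ := fun N => Complex.Gamma (1 + a - c + N) * Complex.Gamma (1 + a - d + N) *
      (Complex.Gamma (1 + a - c - d + N))⁻¹ * (Complex.Gamma (1 + a + N))⁻¹ with hG
  obtain ⟨C, hC⟩ := norm_poisedWeight_le (1 + a)
  have lim1 : Tendsto (fun N : ℕ => ∑' m, poch c m * poch d m * β m * saalWeight (a - c - d) N m)
      atTop (𝓝 (∑' m, poch c m * poch d m * β m)) := by
    refine tendsto_tsum_of_dominated_convergence (bound := fun m => ‖poch c m * poch d m * β m‖)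
      hβ.norm (fun m => ?_) (Eventually.of_forall fun N m => ?_)
    · simpa using (tendsto_saalWeight (a - c - d) m).const_mul (poch c m * poch d m * β m)
    · rw [norm_mul]
      exact mul_le_of_le_one_right (norm_nonneg _) (norm_saalWeight_le hre N m)
  have lim2 : Tendsto (fun N : ℕ => ∑' r, α r * (poised (1 + a) c r * poised (1 + a) d r) *
      poisedWeight (1 + a) N r)
      atTop (𝓝 (∑' r, α r * (poised (1 + a) c r * poised (1 + a) d r))) := by
    refine tendsto_tsum_of_dominated_convergence
      (bound := fun r => ‖α r * (poised (1 + a) c r * poised (1 + a) d r)‖ * C)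
      (hα.norm.mul_right C) (fun m => ?_) ?_
    · simpa using (tendsto_poisedWeight (1 + a) m).const_mul
        (α m * (poised (1 + a) c m * poised (1 + a) d m))
    · filter_upwards [hC] with N hN r
      rw [norm_mul]
      exact mul_le_mul_of_nonneg_left (hN r) (norm_nonneg _)
  have lim3 := (tendsto_Gamma_quotient a c d).mul lim2
  rw [one_mul] at lim3
  refine tendsto_nhds_unique lim3 ((lim1.const_mul (Complex.Gamma (1 + a - c - d))⁻¹).congr' ?_)
  filter_upwards [eventually_Gamma_ne_zero (1 + a - c), eventually_Gamma_ne_zero (1 + a - d),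
    eventually_Gamma_ne_zero (1 + a)] with N h1 h2 h3
  rw [tsum_eq_sum (s := Finset.range (N + 1)) (fun m hm => by
      rw [saalWeight_eq_zero _ (by simpa [Nat.lt_succ_iff] using hm), mul_zero]),
    tsum_eq_sum (s := Finset.range (N + 1)) (fun m hm => by
      rw [poisedWeight_eq_zero _ (by simpa [Nat.lt_succ_iff] using hm), mul_zero])]
  -- This factor turns the coefficients of the finite lemma into the two weights, which cut both
  -- series off at `N`, and into the Gamma quotient tending to `1`.
  have hfin := congrArg (fun t => t * (N.factorial * (Complex.Gamma (1 + a - c - d + N))⁻¹))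
    (h.sum_eq c d N)
  simp only [Finset.sum_mul] at hfin
  rw [Finset.mul_sum, Finset.mul_sum]
  refine Eq.trans (Finset.sum_congr rfl fun m hm => ?_)
    (hfin.trans (Finset.sum_congr rfl fun r hr => ?_))
  · have e := poch_div_factorial_eq_saalWeight hre (Finset.mem_range_succ_iff.mp hm)
    rw [show 1 + (a - c - d) = 1 + a - c - d by ring] at e
    linear_combination (-(poch c m * poch d m * β m)) * e
  · rw [poisedWeight_eq _ (Finset.mem_range_succ_iff.mp hr), poised, poised]
    obtain ⟨i, rfl⟩ := Nat.exists_eq_add_of_le (Finset.mem_range_succ_iff.mp hr)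
    have e1 : r + i - r = i := by omega
    have q : ∀ z : ℂ, z + r + i = z + (r + i : ℕ) := fun z => by push_cast; ring
    rw [e1, inv_Gamma_eq_poch_mul (1 + a - c + r) i, inv_Gamma_eq_poch_mul (1 + a - d + r) i,
      q, q, inv_Gamma_eq_poch_mul (1 + a + (r + i : ℕ)) r, add_comm ((r + i : ℕ) : ℂ) (1 + a)]
    have h4 : poch (1 + a + (r + i : ℕ)) r ≠ 0 := by
      have := inv_ne_zero h3
      rw [inv_Gamma_eq_poch_mul _ r] at this
      exact left_ne_zero_of_mul this
    generalize (Complex.Gamma (1 + a + (r + i : ℕ) + r))⁻¹ = g1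
    generalize (Complex.Gamma (1 + a - c - d + (r + i : ℕ)))⁻¹ = g2
    have f2 : (i.factorial : ℂ) ≠ 0 := by exact_mod_cast i.factorial_ne_zero
    field_simp

/-! ### Growth estimates uniform in the parameter -/

/-- A sequence whose ratios are at most `1 + τ / k + O(1 / k ^ 2)` is `O(k ^ τ)`, uniformly. -/
lemma exists_growth_bound (τ K : ℝ) (hK : 0 ≤ K) (k₀ : ℕ) :
    ∃ C, 0 ≤ C ∧ ∀ u : ℕ → ℝ, (∀ k, 0 ≤ u k) →
      (∀ k, k₀ ≤ k → u (k + 1) ≤ u k * (1 + τ / (k + 1) + K / (k + 1) ^ 2)) →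
      ∀ k, k₀ ≤ k → u k ≤ C * u k₀ * ((k : ℝ) + 1) ^ τ := by
  -- The comparison sequence is `(k+1)^τ exp(-B/(k+1))`. Its exponential grows by
  -- `exp(B/((k+1)(k+2)))` per step, which absorbs the second-order errors `(|τ|+K)/(k+1)²`; the `2`
  -- comes from `k+2 ≤ 2(k+1)`.
  set B := 2 * (|τ| + K) with hB
  have hB0 : 0 ≤ B := by positivity
  have step : ∀ k : ℕ, Real.exp (τ / (k + 1) + K / (k + 1) ^ 2) * ((k : ℝ) + 1) ^ τ *
      Real.exp (-B / (k + 1)) ≤ ((k + 1 : ℕ) + 1 : ℝ) ^ τ * Real.exp (-B / ((k + 1 : ℕ) + 1)) := by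
    intro k
    have hk : (0 : ℝ) < (k : ℝ) + 1 := by positivity
    have hk2 : (0 : ℝ) < ((k + 1 : ℕ) : ℝ) + 1 := by positivity
    rw [Real.rpow_def_of_pos hk, Real.rpow_def_of_pos hk2, ← Real.exp_add, ← Real.exp_add,
      ← Real.exp_add, Real.exp_le_exp]
    set x : ℝ := 1 / ((k : ℝ) + 1) with hx
    have hx0 : 0 < x := by positivity
    have hlog : Real.log (((k + 1 : ℕ) : ℝ) + 1) = Real.log ((k : ℝ) + 1) + Real.log (1 + x) := by
      rw [← Real.log_mul hk.ne' (by positivity)]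
      congr 1
      rw [hx]; push_cast; field_simp
    have l1 : Real.log (1 + x) ≤ x := by
      have := Real.log_le_sub_one_of_pos (show 0 < 1 + x by positivity); linarith
    have l2 : x - x ^ 2 ≤ Real.log (1 + x) := by
      have h1 := Real.one_sub_inv_le_log_of_pos (show 0 < 1 + x by positivity)
      have h2 : x - x ^ 2 ≤ 1 - (1 + x)⁻¹ := by
        rw [le_sub_iff_add_le, ← le_sub_iff_add_le', inv_le_iff_one_le_mul₀ (by positivity)]
        nlinarith [pow_pos hx0 3]
      linarith
    have l3 : τ * x - τ * Real.log (1 + x) ≤ |τ| * x ^ 2 := by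
      calc τ * x - τ * Real.log (1 + x) = τ * (x - Real.log (1 + x)) := by ring
        _ ≤ |τ| * (x - Real.log (1 + x)) :=
          mul_le_mul_of_nonneg_right (le_abs_self τ) (by linarith)
        _ ≤ |τ| * x ^ 2 := mul_le_mul_of_nonneg_left (by linarith) (abs_nonneg τ)
    have l4 : (|τ| + K) * x ^ 2 ≤ B * x - B / (((k + 1 : ℕ) : ℝ) + 1) := by
      have e : B * x - B / (((k + 1 : ℕ) : ℝ) + 1) = B * (x * (1 / ((k : ℝ) + 2))) := by
        rw [hx]; push_cast; field_simp; ring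
      have h2 : x ≤ 2 * (1 / ((k : ℝ) + 2)) := by
        rw [hx]
        rw [mul_one_div, div_le_div_iff₀ hk (by positivity)]
        linarith
      rw [e, hB]
      have : x * x ≤ x * (2 * (1 / ((k : ℝ) + 2))) := mul_le_mul_of_nonneg_left h2 hx0.le
      have h3 : 0 ≤ |τ| + K := by positivity
      nlinarith [mul_le_mul_of_nonneg_left this h3]
    have e1 : τ / ((k : ℝ) + 1) = τ * x := by rw [hx]; ring
    have e2 : K / ((k : ℝ) + 1) ^ 2 = K * x ^ 2 := by rw [hx, div_pow, one_pow, mul_one_div]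
    have e3 : -B / ((k : ℝ) + 1) = -(B * x) := by rw [hx]; ring
    rw [e1, e2, e3, hlog, neg_div]
    nlinarith
  refine ⟨Real.exp (B / (k₀ + 1)) / ((k₀ : ℝ) + 1) ^ τ, by positivity, fun u hu hr k hk => ?_⟩
  have key : u k ≤ Real.exp (B / (k₀ + 1)) / ((k₀ : ℝ) + 1) ^ τ * u k₀ *
      (((k : ℝ) + 1) ^ τ * Real.exp (-B / (k + 1))) := by
    induction k, hk using Nat.le_induction with
    | base =>
      apply le_of_eq
      rw [neg_div, Real.exp_neg]
      have : ((k₀ : ℝ) + 1) ^ τ ≠ 0 := (Real.rpow_pos_of_pos (by positivity) τ).ne'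
      field_simp
    | succ k hk ih =>
      set A := Real.exp (B / (k₀ + 1)) / ((k₀ : ℝ) + 1) ^ τ * u k₀ with hA
      have hA0 : 0 ≤ A := mul_nonneg (by positivity) (hu _)
      calc u (k + 1) ≤ u k * (1 + τ / (k + 1) + K / (k + 1) ^ 2) := hr k hk
        _ ≤ u k * Real.exp (τ / (k + 1) + K / (k + 1) ^ 2) := by
          refine mul_le_mul_of_nonneg_left ?_ (hu k)
          have := Real.add_one_le_exp (τ / ((k : ℝ) + 1) + K / (k + 1) ^ 2)
          linarith
        _ ≤ A * (((k : ℝ) + 1) ^ τ * Real.exp (-B / (k + 1))) *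
            Real.exp (τ / (k + 1) + K / (k + 1) ^ 2) :=
          mul_le_mul_of_nonneg_right ih (Real.exp_pos _).le
        _ = A * (Real.exp (τ / (k + 1) + K / (k + 1) ^ 2) * ((k : ℝ) + 1) ^ τ *
      Real.exp (-B / (k + 1))) := by ring
        _ ≤ _ := mul_le_mul_of_nonneg_left (step k) hA0
  refine key.trans ?_
  refine mul_le_mul_of_nonneg_left ?_ (mul_nonneg (by positivity) (hu _))
  refine mul_le_of_le_one_right (by positivity) ?_
  rw [Real.exp_le_one_iff, neg_div, neg_nonpos]
  positivity

/-- This is `x ≤ (1 + x²)/2` at `x = ‖1 + z‖`. To first order only `Re z` enters, which is what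
makes the growth exponents sharp. -/
lemma norm_one_add_le (z : ℂ) : ‖1 + z‖ ≤ 1 + z.re + ‖z‖ ^ 2 / 2 := by
  have h : ‖1 + z‖ ^ 2 = 1 + 2 * z.re + ‖z‖ ^ 2 := by
    rw [Complex.sq_norm, Complex.sq_norm, Complex.normSq_apply, Complex.normSq_apply]
    simp; ring
  nlinarith [sq_nonneg (‖1 + z‖ - 1)]

/-- The part of a left half-plane in a disc. -/
def halfDisc (ρ σ : ℝ) : Set ℂ := {c | ‖c‖ ≤ ρ ∧ c.re ≤ σ}

lemma exists_norm_poch_le (ρ σ : ℝ) :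
    ∃ C, ∀ c ∈ halfDisc ρ σ, ∀ k : ℕ,
      ‖poch c k‖ ≤ C * k.factorial * ((k : ℝ) + 1) ^ (σ - 1) := by
  obtain ⟨C, -, hC⟩ := exists_growth_bound (σ - 1) ((ρ + 1) ^ 2 / 2) (by positivity) 0
  refine ⟨C, fun c hc k => ?_⟩
  have h := hC (fun k => ‖poch c k‖ / k.factorial) (fun k => by positivity) ?_ k (Nat.zero_le k)
  · simp only [poch_zero, norm_one, Nat.factorial_zero, Nat.cast_one, div_one, mul_one] at h
    rw [div_le_iff₀ (by positivity)] at h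
    linarith
  · intro k _
    have hk : (0 : ℝ) < (k : ℝ) + 1 := by positivity
    rw [poch_succ, Nat.factorial_succ, norm_mul]
    have h1 : ‖c + k‖ = (k + 1) * ‖1 + (c - 1) / ((k : ℂ) + 1)‖ := by
      have hk' : (k : ℂ) + 1 ≠ 0 := by exact_mod_cast hk.ne'
      have : c + k = ((k + 1 : ℕ) : ℂ) * (1 + (c - 1) / ((k : ℂ) + 1)) := by
        push_cast; field_simp; ring
      rw [this, norm_mul, Complex.norm_natCast]; push_cast; rfl
    have h2 := norm_one_add_le ((c - 1) / ((k : ℂ) + 1))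
    have e : (k : ℂ) + 1 = ((k + 1 : ℝ) : ℂ) := by push_cast; rfl
    have h3 : ((c - 1) / ((k : ℂ) + 1)).re ≤ (σ - 1) / (k + 1) := by
      rw [e, Complex.div_ofReal_re]
      refine div_le_div_of_nonneg_right ?_ hk.le
      simpa using hc.2
    have h4 : ‖(c - 1) / ((k : ℂ) + 1)‖ ^ 2 / 2 ≤ (ρ + 1) ^ 2 / 2 / (k + 1) ^ 2 := by
      rw [norm_div, e, Complex.norm_real, Real.norm_of_nonneg hk.le, div_pow, div_right_comm]
      have : ‖c - 1‖ ≤ ρ + 1 := (norm_sub_le _ _).trans (by simpa using hc.1)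
      gcongr
    rw [h1]
    push_cast
    calc ‖poch c k‖ * ((k + 1) * ‖1 + (c - 1) / ((k : ℂ) + 1)‖) / ((k + 1) * k.factorial)
        = ‖poch c k‖ / k.factorial * ‖1 + (c - 1) / ((k : ℂ) + 1)‖ := by field_simp
      _ ≤ _ := mul_le_mul_of_nonneg_left (by linarith) (by positivity)

lemma exists_norm_inv_Gamma_le (ρ σ : ℝ) :
    ∃ C, ∀ w : ℂ, ‖w‖ ≤ ρ → σ ≤ w.re → ∀ k : ℕ,
      ‖(Complex.Gamma (w + k))⁻¹‖ ≤ C / k.factorial * ((k : ℝ) + 1) ^ (1 - σ) := by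
  -- From `k₀` on, `y = (σ-1)/(k+1) ≥ -1/2`, which gives `1/(1+y) ≤ 1 - y + 2y²` for the ratios of
  -- `k!/|Γ(w+k)|`. The finitely many earlier `k` are bounded by compactness, `1/Γ` being entire.
  obtain ⟨k₀, hk₀⟩ := exists_nat_ge (2 * |σ - 1|)
  obtain ⟨C, hC0, hC⟩ := exists_growth_bound (1 - σ) (2 * (σ - 1) ^ 2) (by positivity) k₀
  have hcont : ∀ k : ℕ, Continuous fun w : ℂ => (Complex.Gamma (w + k))⁻¹ := fun k =>
    Complex.differentiable_one_div_Gamma.continuous.comp (continuous_id.add continuous_const)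
  have hcpt : ∀ k : ℕ, ∃ D, ∀ w ∈ Metric.closedBall (0 : ℂ) ρ,
      ‖(Complex.Gamma (w + k))⁻¹‖ ≤ D := fun k =>
    (isCompact_closedBall (0 : ℂ) ρ).exists_bound_of_continuousOn (hcont k).continuousOn
  choose D hD using hcpt
  set E : ℕ → ℝ := fun k => |D k| * k.factorial * ((k : ℝ) + 1) ^ (σ - 1) with hE
  have hE0 : ∀ k, 0 ≤ E k := fun k => by positivity
  refine ⟨C * (k₀.factorial * |D k₀|) + ∑ k ∈ Finset.range k₀, E k, fun w hw hσ k => ?_⟩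
  have hmem : w ∈ Metric.closedBall (0 : ℂ) ρ := by simpa using hw
  have hDk : ∀ k : ℕ, ‖(Complex.Gamma (w + k))⁻¹‖ ≤ |D k| := fun k =>
    (hD k w hmem).trans (le_abs_self _)
  have hf : (0 : ℝ) < k.factorial := by exact_mod_cast k.factorial_pos
  rw [div_mul_eq_mul_div, le_div_iff₀ hf, mul_comm]
  rcases lt_or_ge k k₀ with hk | hk
  · have h1 : E k ≤ C * (k₀.factorial * |D k₀|) + ∑ k ∈ Finset.range k₀, E k := by
      have := Finset.single_le_sum (f := E) (fun i _ => hE0 i) (Finset.mem_range.mpr hk)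
      have : 0 ≤ C * (k₀.factorial * |D k₀|) := by positivity
      linarith
    refine le_trans ?_ (mul_le_mul_of_nonneg_right h1 (by positivity))
    rw [hE]
    have e : ((k : ℝ) + 1) ^ (σ - 1) * ((k : ℝ) + 1) ^ (1 - σ) = 1 := by
      rw [← Real.rpow_add (by positivity)]; simp
    simp only
    rw [mul_assoc, e, mul_one, mul_comm (|D k|)]
    exact mul_le_mul_of_nonneg_left (hDk k) hf.le
  · have h := hC (fun k => k.factorial * ‖(Complex.Gamma (w + k))⁻¹‖)
      (fun k => by positivity) ?_ k hk
    · refine h.trans (mul_le_mul_of_nonneg_right ?_ (by positivity))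
      have h2 : C * (k₀.factorial * ‖(Complex.Gamma (w + k₀))⁻¹‖) ≤
          C * (k₀.factorial * |D k₀|) := by
        have := hDk k₀
        gcongr
      have := Finset.sum_nonneg (s := Finset.range k₀) fun i _ => hE0 i
      linarith
    · intro k hk
      have hk1 : (0 : ℝ) < (k : ℝ) + 1 := by positivity
      have hkk : (k₀ : ℝ) ≤ k := by exact_mod_cast hk
      rw [inv_Gamma_eq_mul (w + k), norm_mul, Nat.factorial_succ,
        show w + ((k + 1 : ℕ) : ℂ) = w + k + 1 by push_cast; ring]
      set y := (σ - 1) / ((k : ℝ) + 1) with hy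
      have hy1 : -(1 / 2) ≤ y := by
        rw [hy, le_div_iff₀ hk1]
        have := neg_abs_le (σ - 1)
        linarith
      have h1 : ((k : ℝ) + 1) * (1 + y) ≤ ‖w + k‖ := by
        refine le_trans ?_ (Complex.re_le_norm _)
        rw [hy, mul_add, mul_div_cancel₀ _ hk1.ne']
        simp; linarith
      have e : 1 + (1 - σ) / ((k : ℝ) + 1) + 2 * (σ - 1) ^ 2 / (k + 1) ^ 2 = 1 - y + 2 * y ^ 2 := by
        rw [hy]; field_simp; ring
      rw [e]
      set g := ‖(Complex.Gamma (w + k + 1))⁻¹‖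
      have hg : 0 ≤ g := norm_nonneg _
      have hp : 1 ≤ (1 + y) * (1 - y + 2 * y ^ 2) := by nlinarith [sq_nonneg y]
      have hq : 0 ≤ 1 - y + 2 * y ^ 2 := by nlinarith [sq_nonneg (y - 1 / 4)]
      push_cast
      have hkf : (0 : ℝ) ≤ k.factorial := Nat.cast_nonneg _
      calc ((k : ℝ) + 1) * k.factorial * g
          ≤ ((k : ℝ) + 1) * k.factorial * g * ((1 + y) * (1 - y + 2 * y ^ 2)) :=
            le_mul_of_one_le_right (by positivity) hp
        _ = k.factorial * ((((k : ℝ) + 1) * (1 + y)) * g) * (1 - y + 2 * y ^ 2) := by ring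
        _ ≤ k.factorial * (‖w + k‖ * g) * (1 - y + 2 * y ^ 2) := by gcongr

/-- `u c k = O(k ^ τ)`, uniformly in `c ∈ S`. -/
def PolyBdd (S : Set ℂ) (τ : ℝ) (u : ℂ → ℕ → ℂ) : Prop :=
  ∃ C, ∀ c ∈ S, ∀ k : ℕ, ‖u c k‖ ≤ C * ((k : ℝ) + 1) ^ τ

/-- `u c k = O(k ^ τ)` with differences `O(k ^ (τ - 1))`, uniformly in `c ∈ S`. -/
def PolyReg (S : Set ℂ) (τ : ℝ) (u : ℂ → ℕ → ℂ) : Prop :=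
  PolyBdd S τ u ∧ PolyBdd S (τ - 1) fun c k => u c k - u c (k + 1)

lemma PolyBdd.exists_pos {S : Set ℂ} {τ : ℝ} {u : ℂ → ℕ → ℂ} (h : PolyBdd S τ u) :
    ∃ C, 0 ≤ C ∧ ∀ c ∈ S, ∀ k : ℕ, ‖u c k‖ ≤ C * ((k : ℝ) + 1) ^ τ := by
  obtain ⟨C, hC⟩ := h
  refine ⟨|C|, abs_nonneg C, fun c hc k => (hC c hc k).trans ?_⟩
  exact mul_le_mul_of_nonneg_right (le_abs_self C) (by positivity)

lemma PolyBdd.mul {S : Set ℂ} {τ τ' : ℝ} {u v : ℂ → ℕ → ℂ} (hu : PolyBdd S τ u)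
    (hv : PolyBdd S τ' v) : PolyBdd S (τ + τ') fun c k => u c k * v c k := by
  obtain ⟨C, hC0, hC⟩ := hu.exists_pos
  obtain ⟨D, hD0, hD⟩ := hv.exists_pos
  refine ⟨C * D, fun c hc k => ?_⟩
  rw [norm_mul, Real.rpow_add (by positivity)]
  calc ‖u c k‖ * ‖v c k‖ ≤ (C * ((k : ℝ) + 1) ^ τ) * (D * ((k : ℝ) + 1) ^ τ') :=
        mul_le_mul (hC c hc k) (hD c hc k) (norm_nonneg _) (by positivity)
    _ = _ := by ring

lemma PolyBdd.add {S : Set ℂ} {τ : ℝ} {u v : ℂ → ℕ → ℂ} (hu : PolyBdd S τ u)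
    (hv : PolyBdd S τ v) : PolyBdd S τ fun c k => u c k + v c k := by
  obtain ⟨C, hC⟩ := hu
  obtain ⟨D, hD⟩ := hv
  refine ⟨C + D, fun c hc k => (norm_add_le _ _).trans ?_⟩
  rw [add_mul]
  exact add_le_add (hC c hc k) (hD c hc k)

lemma PolyBdd.const_mul {S : Set ℂ} {τ : ℝ} {u : ℂ → ℕ → ℂ} (hu : PolyBdd S τ u) (x : ℂ) :
    PolyBdd S τ fun c k => x * u c k := by
  obtain ⟨C, hC⟩ := hu
  refine ⟨‖x‖ * C, fun c hc k => ?_⟩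
  rw [norm_mul, mul_assoc]
  exact mul_le_mul_of_nonneg_left (hC c hc k) (norm_nonneg _)

lemma PolyBdd.shift {S : Set ℂ} {τ : ℝ} {u : ℂ → ℕ → ℂ} (hu : PolyBdd S τ u) :
    PolyBdd S τ fun c k => u c (k + 1) := by
  obtain ⟨C, hC0, hC⟩ := hu.exists_pos
  refine ⟨C * 2 ^ |τ|, fun c hc k => (hC c hc (k + 1)).trans ?_⟩
  have hk : (0 : ℝ) ≤ k := Nat.cast_nonneg k
  rw [mul_assoc]
  refine mul_le_mul_of_nonneg_left ?_ hC0
  push_cast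
  rcases le_total 0 τ with h | h
  · rw [abs_of_nonneg h, ← Real.mul_rpow (by norm_num) (by positivity)]
    exact Real.rpow_le_rpow (by positivity) (by linarith) h
  · have h1 : ((k : ℝ) + 1 + 1) ^ τ ≤ ((k : ℝ) + 1) ^ τ :=
      Real.rpow_le_rpow_of_nonpos (by positivity) (by linarith) h
    exact h1.trans (le_mul_of_one_le_left (by positivity)
      (Real.one_le_rpow (by norm_num) (abs_nonneg τ)))

lemma PolyBdd.of_mem {S T : Set ℂ} {τ : ℝ} {u : ℂ → ℕ → ℂ} (hu : PolyBdd S τ u) {b : ℂ}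
    (hb : b ∈ S) : PolyBdd T τ fun _ k => u b k := by
  obtain ⟨C, hC⟩ := hu
  exact ⟨C, fun _ _ k => hC b hb k⟩

/-- Discrete Leibniz rule: `uv - u'v' = u(v - v') + (u - u')v'`, a prime denoting the shift of the
index. -/
lemma PolyReg.mul {S : Set ℂ} {τ τ' : ℝ} {u v : ℂ → ℕ → ℂ} (hu : PolyReg S τ u)
    (hv : PolyReg S τ' v) : PolyReg S (τ + τ') fun c k => u c k * v c k := by
  refine ⟨hu.1.mul hv.1, ?_⟩
  have h1 := hu.1.mul hv.2
  have h2 := hu.2.mul hv.1.shift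
  rw [show τ + (τ' - 1) = τ + τ' - 1 by ring] at h1
  rw [show τ - 1 + τ' = τ + τ' - 1 by ring] at h2
  convert h1.add h2 using 3
  ring

lemma PolyReg.const_mul {S : Set ℂ} {τ : ℝ} {u : ℂ → ℕ → ℂ} (hu : PolyReg S τ u) (x : ℂ) :
    PolyReg S τ fun c k => x * u c k := by
  refine ⟨hu.1.const_mul x, ?_⟩
  convert hu.2.const_mul x using 3
  ring

lemma PolyReg.of_mem {S T : Set ℂ} {τ : ℝ} {u : ℂ → ℕ → ℂ} (hu : PolyReg S τ u) {b : ℂ}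
    (hb : b ∈ S) : PolyReg T τ fun _ k => u b k :=
  ⟨hu.1.of_mem hb, hu.2.of_mem hb⟩

lemma mem_halfDisc_self (c : ℂ) : c ∈ halfDisc ‖c‖ c.re := ⟨le_rfl, le_rfl⟩

lemma polyBdd_poised (e : ℂ) (ρ σ : ℝ) :
    PolyBdd (halfDisc ρ σ) (2 * σ - e.re) fun c k => poised e c k := by
  obtain ⟨C, hC⟩ := exists_norm_poch_le ρ σ
  obtain ⟨D, hD⟩ := exists_norm_inv_Gamma_le (‖e‖ + ρ) (e.re - σ)
  refine ⟨C * D, fun c hc k => ?_⟩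
  have h1 := hC c hc k
  have h2 := hD (e - c) ((norm_sub_le _ _).trans (by linarith [hc.1]))
    (by simp; linarith [hc.2]) k
  have hf : (0 : ℝ) < k.factorial := by exact_mod_cast k.factorial_pos
  simp only [poised]
  rw [norm_mul]
  calc ‖poch c k‖ * ‖(Complex.Gamma (e - c + k))⁻¹‖
      ≤ (C * k.factorial * ((k : ℝ) + 1) ^ (σ - 1)) *
        (D / k.factorial * ((k : ℝ) + 1) ^ (1 - (e.re - σ))) :=
        mul_le_mul h1 h2 (norm_nonneg _) ((norm_nonneg _).trans h1)
    _ = C * D * (((k : ℝ) + 1) ^ (σ - 1) * ((k : ℝ) + 1) ^ (1 - (e.re - σ))) := by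
        field_simp
    _ = _ := by
        rw [← Real.rpow_add (by positivity)]; congr 2; ring

/-- Contiguity: the difference of consecutive values of `poised e c` is `(e - 2c)` times `poised (e
+ 1) c`, and raising `e` by one lowers the exponent by one. -/
lemma polyReg_poised (e : ℂ) (ρ σ : ℝ) :
    PolyReg (halfDisc ρ σ) (2 * σ - e.re) fun c k => poised e c k := by
  refine ⟨polyBdd_poised e ρ σ, ?_⟩
  have h := polyBdd_poised (e + 1) ρ σ
  have h1 : PolyBdd (halfDisc ρ σ) 0 fun c _ => e - 2 * c := by
    refine ⟨‖e‖ + 2 * ρ, fun c hc k => ?_⟩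
    rw [Real.rpow_zero, mul_one]
    refine (norm_sub_le _ _).trans ?_
    rw [norm_mul]
    have := hc.1
    simp; linarith
  have h2 := h1.mul h
  rw [show (0 : ℝ) + (2 * σ - (e + 1).re) = 2 * σ - e.re - 1 by simp; ring] at h2
  convert h2 using 3 with c k
  simp only [poised]
  rw [poch_succ, inv_Gamma_eq_mul (e - c + k),
    show e - c + (k + 1 : ℕ) = e - c + k + 1 by push_cast; ring,
    show e + 1 - c + (k : ℂ) = e - c + k + 1 by ring]
  ring

lemma polyReg_poised_const (S : Set ℂ) (e d : ℂ) :
    PolyReg S (2 * d.re - e.re) fun _ k => poised e d k :=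
  (polyReg_poised e ‖d‖ d.re).of_mem (mem_halfDisc_self d)

lemma poch_ne_zero {b : ℂ} (hb : ¬ IsNonposInt b) (k : ℕ) : poch b k ≠ 0 := by
  induction k with
  | zero => simp
  | succ k ih =>
    rw [poch_succ]
    exact mul_ne_zero ih fun h => hb ⟨k, eq_neg_of_add_eq_zero_left h⟩

lemma Gamma_ne_zero_of_not_isNonposInt {b : ℂ} (hb : ¬ IsNonposInt b) : Complex.Gamma b ≠ 0 :=
  Complex.Gamma_ne_zero fun m h => hb ⟨m, h⟩

/-- Every quotient of Pochhammer symbols is a `poised` factor with `e = b + b'`, so the estimates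
for `poised` cover the coefficients of both Bailey pairs. -/
lemma poch_div_poch_eq {b b' : ℂ} (hb : ¬ IsNonposInt b') (k : ℕ) :
    poch b k / poch b' k = Complex.Gamma b' * poised (b + b') b k := by
  have h0 := Gamma_ne_zero_of_not_isNonposInt hb
  have h1 := poch_ne_zero hb k
  have h2 := inv_Gamma_eq_poch_mul b' k
  have h3 : (Complex.Gamma (b' + k))⁻¹ = (Complex.Gamma b')⁻¹ / poch b' k := by
    rw [h2]; field_simp
  rw [poised, add_sub_cancel_left, h3]
  field_simp

lemma polyReg_poch_div_poch (S : Set ℂ) (b : ℂ) {b' : ℂ} (hb : ¬ IsNonposInt b') :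
    PolyReg S (b.re - b'.re) fun _ k => poch b k / poch b' k := by
  have h := (polyReg_poised_const S (b + b') b).const_mul (Complex.Gamma b')
  rw [show 2 * b.re - (b + b').re = b.re - b'.re by simp; ring] at h
  simpa only [poch_div_poch_eq hb] using h

lemma not_isNonposInt_one : ¬ IsNonposInt 1 := by
  rintro ⟨m, hm⟩
  have := congrArg Complex.re hm
  simp at this
  have : (0 : ℝ) ≤ m := Nat.cast_nonneg m
  linarith

lemma poch_one (k : ℕ) : poch 1 k = k.factorial := by
  induction k with
  | zero => simp
  | succ k ih => rw [poch_succ, ih, Nat.factorial_succ]; push_cast; ring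

lemma polyReg_poch_div_factorial (S : Set ℂ) (b : ℂ) :
    PolyReg S (b.re - 1) fun _ k => poch b k / (k.factorial : ℂ) := by
  simpa [poch_one] using polyReg_poch_div_poch S b not_isNonposInt_one

lemma polyBdd_poch_div_factorial (ρ σ : ℝ) :
    PolyBdd (halfDisc ρ σ) (σ - 1) fun c k => poch c k / (k.factorial : ℂ) := by
  obtain ⟨C, hC⟩ := exists_norm_poch_le ρ σ
  refine ⟨C, fun c hc k => ?_⟩
  have hf : (0 : ℝ) < k.factorial := by exact_mod_cast k.factorial_pos
  rw [norm_div, Complex.norm_natCast, div_le_iff₀ hf]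
  linarith [hC c hc k]

lemma polyReg_linear (S : Set ℂ) (a : ℂ) : PolyReg S 1 fun _ k => a + 2 * k := by
  constructor
  · refine ⟨‖a‖ + 2, fun _ _ k => ?_⟩
    rw [Real.rpow_one]
    refine (norm_add_le _ _).trans ?_
    rw [norm_mul, Complex.norm_natCast]
    have : (0 : ℝ) ≤ k := Nat.cast_nonneg k
    have := norm_nonneg a
    simp
    nlinarith
  · refine ⟨2, fun _ _ k => ?_⟩
    simp only [sub_self, Real.rpow_zero, mul_one]
    rw [show a + 2 * (k : ℂ) - (a + 2 * (k + 1 : ℕ)) = -2 by push_cast; ring]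
    simp

lemma summable_natCast_add_one_rpow {τ : ℝ} (h : τ < -1) :
    Summable fun k : ℕ => ((k : ℝ) + 1) ^ τ := by
  have := (summable_nat_add_iff 1).mpr (Real.summable_nat_rpow.mpr h)
  simpa using this

lemma PolyBdd.summable {S : Set ℂ} {τ : ℝ} {u : ℂ → ℕ → ℂ} (h : PolyBdd S τ u) (hτ : τ < -1)
    {c : ℂ} (hc : c ∈ S) : Summable (u c) := by
  obtain ⟨C, hC⟩ := h
  exact Summable.of_norm_bounded ((summable_natCast_add_one_rpow hτ).mul_left C) (hC c hc)

lemma PolyBdd.tendsto_zero {S : Set ℂ} {τ : ℝ} {u : ℂ → ℕ → ℂ} (h : PolyBdd S τ u) (hτ : τ < 0)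
    {c : ℂ} (hc : c ∈ S) : Tendsto (u c) atTop (𝓝 0) := by
  obtain ⟨C, hC⟩ := h
  refine squeeze_zero_norm (hC c hc) ?_
  have h1 := (tendsto_rpow_neg_atTop (neg_pos.mpr hτ)).comp
    ((tendsto_natCast_atTop_atTop (R := ℝ)).atTop_add tendsto_const_nhds (C := 1))
  simpa using h1.const_mul C

/-! ### Analytic continuation of Bailey's lemma -/

/-- Weierstrass M-test near `c₀`: on a bounded piece of `Re c < σ`, with `Re c₀ < σ < h`, the terms
are `O(k^(Bσ+A))` uniformly. -/
lemma differentiableOn_tsum_halfPlane {F : ℂ → ℕ → ℂ} {A B h : ℝ}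
    (hd : ∀ k, Differentiable ℂ fun c => F c k)
    (hF : ∀ ρ σ, PolyBdd (halfDisc ρ σ) (B * σ + A) F)
    (hh : ∀ σ < h, B * σ + A < -1) :
    DifferentiableOn ℂ (fun c => ∑' k, F c k) {c | c.re < h} := by
  intro c₀ hc₀
  have hc₀' : c₀.re < h := hc₀
  obtain ⟨σ, hσ1, hσ2⟩ := exists_between hc₀'
  obtain ⟨C, hC⟩ := hF (‖c₀‖ + 1) σ
  set U : Set ℂ := {c | ‖c‖ < ‖c₀‖ + 1 ∧ c.re < σ} with hU
  have hUo : IsOpen U := (isOpen_lt continuous_norm continuous_const).inter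
    (isOpen_lt Complex.continuous_re continuous_const)
  have h1 : DifferentiableOn ℂ (fun c => ∑' k, F c k) U :=
    Complex.differentiableOn_tsum_of_summable_norm
      ((summable_natCast_add_one_rpow (hh σ hσ2)).mul_left C)
      (fun k => (hd k).differentiableOn) hUo
      (fun k c hc => hC c ⟨hc.1.le, hc.2.le⟩ k)
  exact (h1.differentiableAt (hUo.mem_nhds ⟨by linarith, hσ1⟩)).differentiableWithinAt

lemma eq_of_eq_on_left {F G : ℂ → ℂ} {h h' : ℝ} (hF : DifferentiableOn ℂ F {c | c.re < h})
    (hG : DifferentiableOn ℂ G {c | c.re < h}) (hFG : ∀ c : ℂ, c.re < h' → F c = G c)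
    {c : ℂ} (hc : c.re < h) : F c = G c := by
  have hopen : ∀ h : ℝ, IsOpen {c : ℂ | c.re < h} := fun h =>
    isOpen_lt Complex.continuous_re continuous_const
  set z : ℂ := ((min h h' - 1 : ℝ) : ℂ) with hz
  have hz1 : z.re < h := by
    rw [hz, Complex.ofReal_re]; linarith [min_le_left h h']
  have hz2 : z.re < h' := by
    rw [hz, Complex.ofReal_re]; linarith [min_le_right h h']
  refine (hF.analyticOnNhd (hopen h)).eqOn_of_preconnected_of_eventuallyEq
    (hG.analyticOnNhd (hopen h)) (convex_halfSpace_re_lt h).isPreconnected hz1 ?_ hc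
  filter_upwards [(hopen h').mem_nhds hz2] with c hc using hFG c hc

lemma differentiable_poch (k : ℕ) : Differentiable ℂ fun c => poch c k :=
  (ascPochhammer ℂ k).differentiable

lemma differentiable_poised (e : ℂ) (k : ℕ) : Differentiable ℂ fun c => poised e c k :=
  (differentiable_poch k).mul
    (Complex.differentiable_one_div_Gamma.comp (by fun_prop : Differentiable ℂ fun c => e - c + k))

lemma polyBdd_poch_mul_poch {β : ℕ → ℂ} {l : ℝ}
    (hβ : PolyBdd Set.univ l fun _ m => β m * (m.factorial : ℂ) ^ 2) (d : ℂ) (ρ σ : ℝ) :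
    PolyBdd (halfDisc ρ σ) (1 * σ + (d.re - 2 + l)) fun c m => poch c m * poch d m * β m := by
  have h := ((polyBdd_poch_div_factorial ρ σ).mul
    (polyReg_poch_div_factorial (halfDisc ρ σ) d).1).mul
    (hβ.of_mem (T := halfDisc ρ σ) (Set.mem_univ 0))
  rw [show σ - 1 + (d.re - 1) + l = 1 * σ + (d.re - 2 + l) by ring] at h
  convert h using 3 with c m
  have f : (m.factorial : ℂ) ≠ 0 := by exact_mod_cast m.factorial_ne_zero
  field_simp

lemma polyBdd_mul_poised {α : ℕ → ℂ} {κ : ℝ} (hα : PolyBdd Set.univ κ fun _ => α) (e d : ℂ)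
    (ρ σ : ℝ) : PolyBdd (halfDisc ρ σ) (2 * σ + (κ + 2 * d.re - 2 * e.re))
      fun c r => α r * (poised e c r * poised e d r) := by
  have h := (hα.of_mem (T := halfDisc ρ σ) (Set.mem_univ 0)).mul
    ((polyBdd_poised e ρ σ).mul (polyReg_poised_const (halfDisc ρ σ) e d).1)
  rwa [show κ + (2 * σ - e.re + (2 * d.re - e.re)) = 2 * σ + (κ + 2 * d.re - 2 * e.re) by ring] at h

lemma differentiable_inv_Gamma_sub (e d : ℂ) :
    Differentiable ℂ fun c => (Complex.Gamma (e - c - d))⁻¹ :=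
  Complex.differentiable_one_div_Gamma.comp (by fun_prop : Differentiable ℂ fun c => e - c - d)

section
variable {a : ℂ} {α β : ℕ → ℂ} {κ l : ℝ}

lemma summable_poch_mul_poch (hβ : PolyBdd Set.univ l fun _ m => β m * (m.factorial : ℂ) ^ 2)
    {c d : ℂ} (h : c.re + d.re + l < 1) : Summable fun m => poch c m * poch d m * β m :=
  (polyBdd_poch_mul_poch hβ d ‖c‖ c.re).summable (by linarith) (mem_halfDisc_self c)

lemma summable_mul_poised (hα : PolyBdd Set.univ κ fun _ => α)
    {e c d : ℂ} (h : κ + 2 * c.re + 2 * d.re - 2 * e.re < -1) :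
    Summable fun r => α r * (poised e c r * poised e d r) :=
  (polyBdd_mul_poised hα e d ‖c‖ c.re).summable (by linarith) (mem_halfDisc_self c)

lemma differentiableOn_poch_side
    (hβ : PolyBdd Set.univ l fun _ m => β m * (m.factorial : ℂ) ^ 2) (e d : ℂ) {h : ℝ}
    (hh : h + d.re + l ≤ 1) :
    DifferentiableOn ℂ (fun c => (Complex.Gamma (e - c - d))⁻¹ *
      ∑' m, poch c m * poch d m * β m) {c | c.re < h} :=
  (differentiable_inv_Gamma_sub e d).differentiableOn.mul <|
    differentiableOn_tsum_halfPlane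
      (fun k => ((differentiable_poch k).mul_const _).mul_const _)
      (fun ρ σ => polyBdd_poch_mul_poch hβ d ρ σ) (fun σ hσ => by linarith)

/-- Bailey's lemma, absolutely convergent case. -/
theorem IsBaileyPair.tsum_eq (hp : IsBaileyPair a α β)
    (hα : PolyBdd Set.univ κ fun _ => α)
    (hβ : PolyBdd Set.univ l fun _ m => β m * (m.factorial : ℂ) ^ 2) {c d : ℂ}
    (h1 : κ + 2 * c.re + 2 * d.re - 2 * (1 + a).re < -1) (h2 : c.re + d.re + l < 1) :
    ∑' r, α r * (poised (1 + a) c r * poised (1 + a) d r) =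
      (Complex.Gamma (1 + a - c - d))⁻¹ * ∑' m, poch c m * poch d m * β m := by
  -- On `Re c < h` both series converge absolutely; left of `Re (a - d)` the dominated-convergence
  -- version applies.
  set h := min ((2 * (1 + a).re - 2 * d.re - κ - 1) / 2) (1 - d.re - l) with hh
  have hl := min_le_left ((2 * (1 + a).re - 2 * d.re - κ - 1) / 2) (1 - d.re - l)
  have hr := min_le_right ((2 * (1 + a).re - 2 * d.re - κ - 1) / 2) (1 - d.re - l)
  rw [← hh] at hl hr
  refine eq_of_eq_on_left (h := h) (h' := min h (a - d).re)
    (F := fun c => ∑' r, α r * (poised (1 + a) c r * poised (1 + a) d r))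
    (G := fun c => (Complex.Gamma (1 + a - c - d))⁻¹ * ∑' m, poch c m * poch d m * β m)
    ?_ (differentiableOn_poch_side hβ (1 + a) d (by linarith)) ?_
    (lt_min (by linarith) (by linarith))
  · exact differentiableOn_tsum_halfPlane
      (fun k => ((differentiable_poised _ k).mul_const _).const_mul _)
      (fun ρ σ => polyBdd_mul_poised hα (1 + a) d ρ σ) (fun σ hσ => by linarith)
  · intro c hc
    have hc1 := hc.trans_le (min_le_left _ _)
    have hc2 := hc.trans_le (min_le_right _ _)
    refine hp.tsum_eq_of_re_nonneg ?_ (summable_poch_mul_poch hβ (by linarith))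
      (summable_mul_poised hα (by linarith))
    simp at hc2 ⊢
    linarith

/-- Bailey's lemma for an alternating first member, conditionally convergent case. -/
theorem IsBaileyPair.tendsto_sum_of_alternating {f : ℕ → ℂ}
    (hp : IsBaileyPair a (fun r => (-1) ^ r * f r) β)
    (hf : PolyReg Set.univ κ fun _ => f)
    (hβ : PolyBdd Set.univ l fun _ m => β m * (m.factorial : ℂ) ^ 2) {c d : ℂ}
    (h1 : κ + 2 * c.re + 2 * d.re - 2 * (1 + a).re < 0) (h2 : c.re + d.re + l < 1) :
    Tendsto (fun N => ∑ r ∈ Finset.range N,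
        (-1) ^ r * f r * (poised (1 + a) c r * poised (1 + a) d r)) atTop
      (𝓝 ((Complex.Gamma (1 + a - c - d))⁻¹ * ∑' m, poch c m * poch d m * β m)) := by
  set F : ℂ → ℕ → ℂ := fun c r => f r * (poised (1 + a) c r * poised (1 + a) d r) with hF
  -- Averaging neighbours: `∑ (-1)^k F_k = F_0/2 + ½ ∑ (-1)^k (F_k - F_(k+1))`. The differences
  -- decay one power faster, so `E` is analytic wherever the terms `F_k` are `O(k^τ)` with `τ < 0`.
  set E : ℂ → ℂ := fun c => F c 0 / 2 + 1 / 2 * ∑' k, (-1) ^ k * (F c k - F c (k + 1)) with hE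
  have hreg : ∀ ρ σ, PolyReg (halfDisc ρ σ) (2 * σ + (κ + 2 * d.re - 2 * (1 + a).re)) F := by
    intro ρ σ
    have h := (hf.of_mem (T := halfDisc ρ σ) (Set.mem_univ 0)).mul
      ((polyReg_poised (1 + a) ρ σ).mul (polyReg_poised_const (halfDisc ρ σ) (1 + a) d))
    rwa [show κ + (2 * σ - (1 + a).re + (2 * d.re - (1 + a).re)) =
      2 * σ + (κ + 2 * d.re - 2 * (1 + a).re) by ring] at h
  have hdiff : ∀ ρ σ, PolyBdd (halfDisc ρ σ) (2 * σ + (κ + 2 * d.re - 2 * (1 + a).re - 1))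
      fun c k => (-1) ^ k * (F c k - F c (k + 1)) := by
    intro ρ σ
    obtain ⟨C, hC⟩ := (hreg ρ σ).2
    refine ⟨C, fun c hc k => ?_⟩
    have := hC c hc k
    rw [norm_mul, norm_pow, norm_neg, norm_one, one_pow, one_mul]
    rwa [show 2 * σ + (κ + 2 * d.re - 2 * (1 + a).re) - 1 =
      2 * σ + (κ + 2 * d.re - 2 * (1 + a).re - 1) by ring] at this
  have partialSum : ∀ (c : ℂ) (N : ℕ), ∑ r ∈ Finset.range N,
      (-1) ^ r * f r * (poised (1 + a) c r * poised (1 + a) d r) =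
      F c 0 / 2 - (-1) ^ N * F c N / 2 +
        1 / 2 * ∑ k ∈ Finset.range N, (-1) ^ k * (F c k - F c (k + 1)) := by
    intro c N
    induction N with
    | zero => simp
    | succ N ih =>
      rw [Finset.sum_range_succ, ih, Finset.sum_range_succ,
        show (-1) ^ N * f N * (poised (1 + a) c N * poised (1 + a) d N) = (-1) ^ N * F c N by
          rw [hF]; ring]
      ring
  have hlim : ∀ c : ℂ, κ + 2 * c.re + 2 * d.re - 2 * (1 + a).re < 0 →
      Tendsto (fun N => ∑ r ∈ Finset.range N,
        (-1) ^ r * f r * (poised (1 + a) c r * poised (1 + a) d r)) atTop (𝓝 (E c)) := by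
    intro c hc
    simp only [partialSum]
    have t1 := ((hdiff ‖c‖ c.re).summable (by linarith) (mem_halfDisc_self c)).hasSum.tendsto_sum_nat
    have t2 : Tendsto (fun N => (-1) ^ N * F c N / 2) atTop (𝓝 0) := by
      have t3 := (hreg ‖c‖ c.re).1.tendsto_zero (by linarith) (mem_halfDisc_self c)
      rw [tendsto_zero_iff_norm_tendsto_zero] at t3 ⊢
      simpa using t3.div_const 2
    have := (t2.const_sub (F c 0 / 2)).add (t1.const_mul (1 / 2))
    simpa [hE] using this
  set h := min ((2 * (1 + a).re - 2 * d.re - κ) / 2) (1 - d.re - l) with hh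
  have hl := min_le_left ((2 * (1 + a).re - 2 * d.re - κ) / 2) (1 - d.re - l)
  have hr := min_le_right ((2 * (1 + a).re - 2 * d.re - κ) / 2) (1 - d.re - l)
  rw [← hh] at hl hr
  have key : E c = (Complex.Gamma (1 + a - c - d))⁻¹ * ∑' m, poch c m * poch d m * β m := by
    -- Left of `h - 1` the original series converges absolutely, and left of `Re (a - d)` the known
    -- case applies.
    refine eq_of_eq_on_left (h := h) (h' := min (h - 1) (a - d).re) (F := E)
      (G := fun c => (Complex.Gamma (1 + a - c - d))⁻¹ * ∑' m, poch c m * poch d m * β m)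
      ?_ (differentiableOn_poch_side hβ (1 + a) d (by linarith)) ?_
      (lt_min (by linarith) (by linarith))
    · have hFd : ∀ k, Differentiable ℂ fun c => F c k := fun k =>
        ((differentiable_poised _ k).mul_const _).const_mul _
      refine ((hFd 0).div_const 2).differentiableOn.add (DifferentiableOn.const_mul ?_ _)
      exact differentiableOn_tsum_halfPlane
        (fun k => ((hFd k).sub (hFd (k + 1))).const_mul _) hdiff (fun σ hσ => by linarith)
    · intro c hc
      have hc1 := hc.trans_le (min_le_left _ _)
      have hc2 := hc.trans_le (min_le_right _ _)
      have hα : PolyBdd Set.univ κ fun _ r => (-1) ^ r * f r := by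
        obtain ⟨C, hC⟩ := hf.1
        refine ⟨C, fun c hc k => ?_⟩
        simpa using hC c hc k
      have hs := summable_mul_poised hα (e := 1 + a) (c := c) (d := d) (by linarith)
      rw [← hp.tsum_eq_of_re_nonneg (by simp at hc2 ⊢; linarith)
        (summable_poch_mul_poch hβ (by linarith)) hs]
      exact tendsto_nhds_unique (hlim c (by linarith)) hs.hasSum.tendsto_sum_nat
  rw [← key]
  exact hlim c h1

lemma poch_neg_natCast_eq_zero {p m : ℕ} (h : p < m) : poch (-(p : ℂ)) m = 0 := by
  obtain ⟨i, rfl⟩ := Nat.exists_eq_add_of_lt h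
  rw [show p + i + 1 = p + 1 + i by ring, poch_add, poch_succ]
  simp

/-- Bailey's lemma, terminating case. -/
theorem IsBaileyPair.sum_eq_of_terminating (hp : IsBaileyPair a α β) (p : ℕ) (d : ℂ) :
    ∑ r ∈ Finset.range (p + 1), α r * (poised (1 + a) (-(p : ℂ)) r * poised (1 + a) d r) =
      (Complex.Gamma (1 + a - d - -(p : ℂ)))⁻¹ *
        ∑ m ∈ Finset.range (p + 1), poch (-(p : ℂ)) m * poch d m * β m := by
  -- Here the continuation is in `d`: both sides are finite sums, entire in `d`, so the bound `d.re
  -- + 1` serves only to include `d`.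
  refine eq_of_eq_on_left (h := d.re + 1) (h' := (a - -(p : ℂ)).re)
    (F := fun d => ∑ r ∈ Finset.range (p + 1),
      α r * (poised (1 + a) (-(p : ℂ)) r * poised (1 + a) d r))
    (G := fun d => (Complex.Gamma (1 + a - d - -(p : ℂ)))⁻¹ *
        ∑ m ∈ Finset.range (p + 1), poch (-(p : ℂ)) m * poch d m * β m) ?_ ?_ ?_ (by linarith)
  · refine (Differentiable.fun_sum fun r _ => ?_).differentiableOn
    exact ((differentiable_poised _ r).const_mul _).const_mul _
  · refine ((differentiable_inv_Gamma_sub _ _).mul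
      (Differentiable.fun_sum fun r _ => ?_)).differentiableOn
    exact ((differentiable_poch r).const_mul _).mul_const _
  · intro d hd
    have z1 : ∀ r ∉ Finset.range (p + 1),
        α r * (poised (1 + a) (-(p : ℂ)) r * poised (1 + a) d r) = 0 := fun r hr => by
      rw [poised, poch_neg_natCast_eq_zero (by simpa [Nat.lt_succ_iff] using hr)]; ring
    have z2 : ∀ m ∉ Finset.range (p + 1), poch (-(p : ℂ)) m * poch d m * β m = 0 := fun m hm => by
      rw [poch_neg_natCast_eq_zero (by simpa [Nat.lt_succ_iff] using hm)]; ring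
    have := hp.tsum_eq_of_re_nonneg (c := -(p : ℂ)) (d := d) (by simp at hd ⊢; linarith)
      (summable_of_ne_finset_zero z2) (summable_of_ne_finset_zero z1)
    rw [tsum_eq_sum z1, tsum_eq_sum z2, show 1 + a - -(p : ℂ) - d = 1 + a - d - -(p : ℂ) by ring]
      at this
    exact this

end

/-! ### Two Bailey pairs with a common second member -/

/-- The common second member of the two Bailey pairs, up to a constant. -/
noncomputable def betaCore (n : ℂ) (m : ℕ) : ℂ :=
  poch (n + 1 / 2) m / (poch (2 * n + 1) m * poch (2 * n + 3 / 2) m * (m.factorial : ℂ))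

/-- The first member, up to sign, of the Bailey pair relative to `3 n + 1`. -/
noncomputable def alphaL (n : ℂ) (r : ℕ) : ℂ :=
  (3 * n + 1 + 2 * r) * (poch (3 * n + 1) r / (r.factorial : ℂ)) *
    (poch (n + 1 / 2) r / poch (2 * n + 3 / 2) r) * (poch (n + 1) r / poch (2 * n + 1) r)

/-- The first member of the Bailey pair relative to `4 n + 2`. -/
noncomputable def alphaR (n : ℂ) (r : ℕ) : ℂ :=
  if Even r then (2 * n + 1 + r) * (poch (2 * n + 1) (r / 2) / ((r / 2).factorial : ℂ)) else 0

section
variable {n : ℂ}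

/-- Taking `b = n + 1/2` and `b' = n + 1` makes `1 + a - b - b'` equal to `n + 1/2`, the numerator
parameter of `betaCore`. -/
lemma isBaileyPair_alphaL (h1 : ¬ IsNonposInt (2 * n + 1)) (h2 : ¬ IsNonposInt (2 * n + 3 / 2)) :
    IsBaileyPair (3 * n + 1) (fun r => (-1) ^ r * alphaL n r)
      (fun m => (3 * n + 1) * (Complex.Gamma (1 + (3 * n + 1)))⁻¹ * betaCore n m) := by
  have e1 : 1 + (3 * n + 1) - (n + 1 / 2) = 2 * n + 3 / 2 := by ring
  have e2 : 1 + (3 * n + 1) - (n + 1) = 2 * n + 1 := by ring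
  have e3 : 2 * n + 3 / 2 - (n + 1) = n + 1 / 2 := by ring
  have h := isBaileyPair_veryWellPoised (3 * n + 1) (n + 1 / 2) (n + 1)
    (by rw [e1]; exact poch_ne_zero h2) (by rw [e2]; exact poch_ne_zero h1)
  rw [e1, e2, e3] at h
  have hβ : betaCore n = fun m => poch (n + 1 / 2) m /
      (poch (2 * n + 3 / 2) m * poch (2 * n + 1) m * (m.factorial : ℂ)) := by
    funext m; rw [betaCore, mul_comm (poch (2 * n + 1) m)]
  rw [hβ]
  exact h

/-- Taking `x = 2n + 1` in the even pair gives `x/2 = n + 1/2` and `x + 1/2 = 2n + 3/2`: again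
`betaCore`. The condition on `2x + k` splits by the parity of `k` into the two hypotheses. -/
lemma isBaileyPair_alphaR (h1 : ¬ IsNonposInt (2 * n + 1)) (h2 : ¬ IsNonposInt (2 * n + 3 / 2)) :
    IsBaileyPair (2 * (2 * n + 1)) (alphaR n)
      (fun m => (2 * n + 1) * (Complex.Gamma (1 + 2 * (2 * n + 1)))⁻¹ * betaCore n m) := by
  have h := isBaileyPair_even (2 * n + 1) (fun k hk => ?_)
  · have e1 : (2 * n + 1) / 2 = n + 1 / 2 := by ring
    have e2 : 2 * n + 1 + 1 / 2 = 2 * n + 3 / 2 := by ring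
    rw [e1, e2] at h
    exact h
  · rcases Nat.even_or_odd' k with ⟨j, rfl | rfl⟩
    · exact h1 ⟨j, by push_cast at hk; linear_combination hk / 2⟩
    · exact h2 ⟨j, by push_cast at hk; linear_combination hk / 2⟩

lemma polyBdd_betaCore (h1 : ¬ IsNonposInt (2 * n + 1)) (h2 : ¬ IsNonposInt (2 * n + 3 / 2))
    (x : ℂ) : PolyBdd Set.univ (-3 * n.re - 1)
      fun _ m => x * betaCore n m * (m.factorial : ℂ) ^ 2 := by
  have h := ((polyReg_poch_div_poch Set.univ (n + 1 / 2) h1).1.mul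
    (polyReg_poch_div_poch Set.univ 1 h2).1).const_mul x
  have e : (n + 1 / 2).re - (2 * n + 1).re + ((1 : ℂ).re - (2 * n + 3 / 2).re) =
      -3 * n.re - 1 := by
    simp [Complex.add_re]; ring
  rw [e] at h
  refine (congrArg (PolyBdd Set.univ _) (funext fun _ => funext fun m => ?_)).mp h
  rw [betaCore, poch_one]
  have := poch_ne_zero h1 m
  have := poch_ne_zero h2 m
  have f : (m.factorial : ℂ) ≠ 0 := by exact_mod_cast m.factorial_ne_zero
  field_simp

lemma polyReg_alphaL (h1 : ¬ IsNonposInt (2 * n + 1)) (h2 : ¬ IsNonposInt (2 * n + 3 / 2)) :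
    PolyReg Set.univ n.re fun _ => alphaL n := by
  have h := (((polyReg_linear Set.univ (3 * n + 1)).mul
    (polyReg_poch_div_factorial Set.univ (3 * n + 1))).mul
    (polyReg_poch_div_poch Set.univ (n + 1 / 2) h2)).mul
    (polyReg_poch_div_poch Set.univ (n + 1) h1)
  have e : 1 + ((3 * n + 1).re - 1) + ((n + 1 / 2).re - (2 * n + 3 / 2).re) +
      ((n + 1).re - (2 * n + 1).re) = n.re := by
    simp [Complex.add_re]; ring
  rwa [e] at h

lemma polyBdd_alphaR : PolyBdd Set.univ (2 * n.re + 1) fun _ => alphaR n := by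
  obtain ⟨C, hC0, hC⟩ := (polyReg_poch_div_factorial Set.univ (2 * n + 1)).1.exists_pos
  have e : (2 * n + 1).re - 1 = 2 * n.re := by simp
  rw [e] at hC
  refine ⟨(‖2 * n + 1‖ + 1) * (C * 2 ^ |2 * n.re|), fun _ _ r => ?_⟩
  simp only [alphaR]
  split_ifs with hr
  · obtain ⟨k, rfl⟩ := hr.two_dvd
    rw [Nat.mul_div_cancel_left k two_pos, norm_mul, Real.rpow_add (by positivity), Real.rpow_one]
    have hk : (0 : ℝ) ≤ k := Nat.cast_nonneg k
    have b1 : ‖2 * n + 1 + ((2 * k : ℕ) : ℂ)‖ ≤ (‖2 * n + 1‖ + 1) * (((2 * k : ℕ) : ℝ) + 1) := by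
      refine (norm_add_le _ _).trans ?_
      rw [Complex.norm_natCast]
      have : (0 : ℝ) ≤ ((2 * k : ℕ) : ℝ) := Nat.cast_nonneg _
      nlinarith [norm_nonneg (2 * n + 1)]
    have b2 : ((k : ℝ) + 1) ^ (2 * n.re) ≤ 2 ^ |2 * n.re| * (((2 * k : ℕ) : ℝ) + 1) ^ (2 * n.re) := by
      push_cast
      rcases le_total 0 (2 * n.re) with h | h
      · have : ((k : ℝ) + 1) ^ (2 * n.re) ≤ (2 * (k : ℝ) + 1) ^ (2 * n.re) :=
          Real.rpow_le_rpow (by positivity) (by linarith) h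
        exact this.trans (le_mul_of_one_le_left (by positivity)
          (Real.one_le_rpow (by norm_num) (abs_nonneg _)))
      · rw [abs_of_nonpos h, Real.rpow_neg (by norm_num), ← div_eq_inv_mul,
          ← Real.div_rpow (by positivity) (by norm_num)]
        exact Real.rpow_le_rpow_of_nonpos (by positivity) (by linarith) h
    calc _ ≤ ((‖2 * n + 1‖ + 1) * (((2 * k : ℕ) : ℝ) + 1)) *
          (C * (2 ^ |2 * n.re| * (((2 * k : ℕ) : ℝ) + 1) ^ (2 * n.re))) :=
          mul_le_mul b1 ((hC 0 (Set.mem_univ 0) k).trans (mul_le_mul_of_nonneg_left b2 hC0))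
            (norm_nonneg _) (by positivity)
      _ = _ := by ring
  · rw [norm_zero]; positivity

/-- Both well-poised sums are multiples of the same sum. -/
theorem exists_common_sum {c d : ℂ} (h1 : ¬ IsNonposInt (2 * n + 1))
    (h2 : ¬ IsNonposInt (2 * n + 3 / 2))
    (h : (0 < (5 * n + 4 - 2 * c - 2 * d).re ∧ 0 < (3 * n + 2 - c - d).re) ∨
      IsNonposInt c ∨ IsNonposInt d) :
    ∃ M : ℂ,
      HasSum (fun r => alphaR n r *
          (poised (1 + 2 * (2 * n + 1)) c r * poised (1 + 2 * (2 * n + 1)) d r))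
        ((Complex.Gamma (1 + 2 * (2 * n + 1) - c - d))⁻¹ *
          ((2 * n + 1) * (Complex.Gamma (1 + 2 * (2 * n + 1)))⁻¹ * M)) ∧
      Tendsto (fun N => ∑ r ∈ Finset.range N, (-1) ^ r * alphaL n r *
          (poised (1 + (3 * n + 1)) c r * poised (1 + (3 * n + 1)) d r)) atTop
        (𝓝 ((Complex.Gamma (1 + (3 * n + 1) - c - d))⁻¹ *
          ((3 * n + 1) * (Complex.Gamma (1 + (3 * n + 1)))⁻¹ * M))) := by
  have terminating : ∀ (p : ℕ) (d : ℂ), ∃ M : ℂ,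
      HasSum (fun r => alphaR n r *
          (poised (1 + 2 * (2 * n + 1)) (-(p : ℂ)) r * poised (1 + 2 * (2 * n + 1)) d r))
        ((Complex.Gamma (1 + 2 * (2 * n + 1) - d - -(p : ℂ)))⁻¹ *
          ((2 * n + 1) * (Complex.Gamma (1 + 2 * (2 * n + 1)))⁻¹ * M)) ∧
      Tendsto (fun N => ∑ r ∈ Finset.range N, (-1) ^ r * alphaL n r *
          (poised (1 + (3 * n + 1)) (-(p : ℂ)) r * poised (1 + (3 * n + 1)) d r)) atTop
        (𝓝 ((Complex.Gamma (1 + (3 * n + 1) - d - -(p : ℂ)))⁻¹ *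
          ((3 * n + 1) * (Complex.Gamma (1 + (3 * n + 1)))⁻¹ * M))) := by
    intro p d
    have hz : ∀ (e : ℂ) (f : ℕ → ℂ), ∀ r ∉ Finset.range (p + 1),
        f r * (poised e (-(p : ℂ)) r * poised e d r) = 0 := fun e f r hr => by
      rw [poised, poch_neg_natCast_eq_zero (by simpa [Nat.lt_succ_iff] using hr)]; ring
    have hM : ∀ x : ℂ, ∑ m ∈ Finset.range (p + 1), poch (-(p : ℂ)) m * poch d m *
        (x * betaCore n m) =
        x * ∑ m ∈ Finset.range (p + 1), poch (-(p : ℂ)) m * poch d m * betaCore n m := fun x => by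
      rw [Finset.mul_sum]; exact Finset.sum_congr rfl fun m _ => by ring
    refine ⟨∑ m ∈ Finset.range (p + 1), poch (-(p : ℂ)) m * poch d m * betaCore n m, ?_, ?_⟩
    · rw [← hM, ← (isBaileyPair_alphaR h1 h2).sum_eq_of_terminating p d]
      exact hasSum_sum_of_ne_finset_zero (hz _ _)
    · rw [← hM, ← (isBaileyPair_alphaL h1 h2).sum_eq_of_terminating p d]
      exact (hasSum_sum_of_ne_finset_zero (hz _ fun r => (-1) ^ r * alphaL n r)).tendsto_sum_nat
  rcases h with ⟨hc1, hc2⟩ | ⟨p, rfl⟩ | ⟨p, rfl⟩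
  -- `Re (3n+2-c-d) > 0` is exactly what the sum over `betaCore` and the one over `alphaR` need to
  -- converge absolutely by the exponent bounds; `Re (5n+4-2c-2d) > 0` makes the exponent of the
  -- alternating terms negative.
  · have hc1' : 0 < 5 * n.re + 4 - 2 * c.re - 2 * d.re := by simpa using hc1
    have hc2' : 0 < 3 * n.re + 2 - c.re - d.re := by simpa using hc2
    have hM : ∀ x : ℂ, ∑' m, poch c m * poch d m * (x * betaCore n m) =
        x * ∑' m, poch c m * poch d m * betaCore n m := fun x => by
      rw [← tsum_mul_left]; exact tsum_congr fun m => by ring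
    refine ⟨∑' m, poch c m * poch d m * betaCore n m, ?_, ?_⟩
    · have hr : 2 * n.re + 1 + 2 * c.re + 2 * d.re - 2 * (1 + 2 * (2 * n + 1)).re < -1 := by
        simp; linarith
      rw [← hM, ← (isBaileyPair_alphaR h1 h2).tsum_eq polyBdd_alphaR (polyBdd_betaCore h1 h2 _)
        hr (by linarith)]
      exact (summable_mul_poised polyBdd_alphaR hr).hasSum
    · rw [← hM]
      exact (isBaileyPair_alphaL h1 h2).tendsto_sum_of_alternating (polyReg_alphaL h1 h2)
        (polyBdd_betaCore h1 h2 _) (by simp; linarith) (by linarith)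
  · obtain ⟨M, hM⟩ := terminating p d
    refine ⟨M, ?_⟩
    rwa [sub_right_comm (1 + 2 * (2 * n + 1)), sub_right_comm (1 + (3 * n + 1))]
  · obtain ⟨M, hM⟩ := terminating p c
    refine ⟨M, ?_⟩
    simpa only [mul_comm (poised _ (-(p : ℂ)) _)] using hM

/-! ### From Bailey sums to the hypergeometric transformation -/

lemma poch_two_mul (x : ℂ) (k : ℕ) :
    poch x (2 * k) = 4 ^ k * (poch (x / 2) k * poch (x / 2 + 1 / 2) k) := by
  induction k with
  | zero => simp
  | succ k ih =>
    rw [show 2 * (k + 1) = 2 * k + 1 + 1 by ring, poch_succ, poch_succ, ih, poch_succ, poch_succ]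
    push_cast; ring

lemma poised_eq {e c : ℂ} (h : ¬ IsNonposInt (e - c)) (k : ℕ) :
    poised e c k = (Complex.Gamma (e - c))⁻¹ * (poch c k / poch (e - c) k) := by
  rw [poch_div_poch_eq h, add_sub_cancel, inv_mul_cancel_left₀ (Gamma_ne_zero_of_not_isNonposInt h)]

/-- Produces the very-well-poised linear factor from the two parameters differing by one. -/
lemma poch_add_one_div {x : ℂ} (h : ¬ IsNonposInt x) (k : ℕ) :
    poch (x + 1) k / poch x k = (x + k) / x := by
  have h0 : x ≠ 0 := fun h0 => h ⟨0, by simpa using h0⟩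
  have h1 := poch_succ x k
  rw [poch_succ_left] at h1
  rw [div_eq_div_iff (poch_ne_zero h k) h0]
  linear_combination h1

lemma hypTerm_eq_poch (as bs : List ℂ) (z : ℂ) (k : ℕ) :
    hypTerm as bs z k = (as.map fun a => poch a k).prod / (bs.map fun b => poch b k).prod *
      (z ^ k / (k.factorial : ℂ)) := rfl

lemma hypTerm_L_eq_ratio (c d : ℂ) (h0 : ¬ IsNonposInt (3 * n / 2 + 1 / 2)) (k : ℕ) :
    hypTerm (upperL n c d) (lowerL n c d) (-1) k =
      (-1) ^ k * alphaL n k / (3 * n + 1) *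
        ((poch c k / poch (3 * n + 2 - c) k) * (poch d k / poch (3 * n + 2 - d) k)) := by
  have ha : 3 * n + 1 ≠ 0 := fun h => h0 ⟨0, by push_cast; linear_combination h / 2⟩
  have hq := poch_add_one_div h0 k
  rw [show 3 * n / 2 + 1 / 2 + 1 = 3 * n / 2 + 3 / 2 by ring,
    show (3 * n / 2 + 1 / 2 + k) / (3 * n / 2 + 1 / 2) = (3 * n + 1 + 2 * k) / (3 * n + 1) by
      rw [div_eq_div_iff (fun h => h0 ⟨0, by simpa using h⟩) ha]; ring] at hq
  have e2 : hypTerm (upperL n c d) (lowerL n c d) (-1) k =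
      (poch (3 * n / 2 + 3 / 2) k / poch (3 * n / 2 + 1 / 2) k) * ((-1) ^ k *
        (poch (3 * n + 1) k / (k.factorial : ℂ)) *
        (poch (n + 1 / 2) k / poch (2 * n + 3 / 2) k) * (poch (n + 1) k / poch (2 * n + 1) k) *
        (poch c k / poch (3 * n + 2 - c) k) * (poch d k / poch (3 * n + 2 - d) k)) := by
    simp only [hypTerm_eq_poch, upperL, lowerL, List.map_cons, List.map_nil, List.prod_cons,
      List.prod_nil]
    simp only [div_eq_mul_inv, mul_inv, mul_one]
    ring
  rw [e2, hq, alphaL]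
  ring

lemma hypTerm_L {c d : ℂ} (h0 : ¬ IsNonposInt (3 * n / 2 + 1 / 2))
    (hc : ¬ IsNonposInt (3 * n + 2 - c)) (hd : ¬ IsNonposInt (3 * n + 2 - d)) (k : ℕ) :
    hypTerm (upperL n c d) (lowerL n c d) (-1) k =
      Complex.Gamma (3 * n + 2 - c) * Complex.Gamma (3 * n + 2 - d) / (3 * n + 1) *
        ((-1) ^ k * alphaL n k *
          (poised (1 + (3 * n + 1)) c k * poised (1 + (3 * n + 1)) d k)) := by
  rw [hypTerm_L_eq_ratio c d h0, show 1 + (3 * n + 1) = 3 * n + 2 by ring, poised_eq hc,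
    poised_eq hd]
  have g1 := Gamma_ne_zero_of_not_isNonposInt hc
  have g2 := Gamma_ne_zero_of_not_isNonposInt hd
  generalize Complex.Gamma (3 * n + 2 - c) = G1 at g1 ⊢
  generalize Complex.Gamma (3 * n + 2 - d) = G2 at g2 ⊢
  generalize poch c k / poch (3 * n + 2 - c) k = u1
  generalize poch d k / poch (3 * n + 2 - d) k = u2
  field_simp

/-- Duplication merges the half-parameters in pairs into Pochhammer symbols of length `2k`, so the
`k`-th term sits at the even index `2k` of `alphaR`. -/
lemma hypTerm_R_eq_ratio (c d : ℂ) (h0 : ¬ IsNonposInt (n + 1 / 2)) (k : ℕ) :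
    hypTerm (upperR n c d) (lowerR n c d) 1 k =
      alphaR n (2 * k) / (2 * n + 1) * ((poch c (2 * k) / poch (4 * n + 3 - c) (2 * k)) *
        (poch d (2 * k) / poch (4 * n + 3 - d) (2 * k))) := by
  have ha : 2 * n + 1 ≠ 0 := fun h => h0 ⟨0, by push_cast; linear_combination h / 2⟩
  have hq := poch_add_one_div h0 k
  rw [show n + 1 / 2 + 1 = n + 3 / 2 by ring,
    show (n + 1 / 2 + k) / (n + 1 / 2) = (2 * n + 1 + (2 * k : ℕ)) / (2 * n + 1) by
      rw [div_eq_div_iff (fun h => h0 ⟨0, by simpa using h⟩) ha]; push_cast; ring] at hq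
  have dup : ∀ c : ℂ, poch c (2 * k) / poch (4 * n + 3 - c) (2 * k) =
      poch (c / 2) k / poch (2 * n + 3 / 2 - c / 2) k *
        (poch (c / 2 + 1 / 2) k / poch (2 * n + 2 - c / 2) k) := fun c => by
    rw [poch_two_mul, poch_two_mul, mul_div_mul_left _ _ (pow_ne_zero k (by norm_num)),
      mul_div_mul_comm, show (4 * n + 3 - c) / 2 = 2 * n + 3 / 2 - c / 2 by ring,
      show 2 * n + 3 / 2 - c / 2 + 1 / 2 = 2 * n + 2 - c / 2 by ring]
  have e2 : hypTerm (upperR n c d) (lowerR n c d) 1 k =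
      (poch (n + 3 / 2) k / poch (n + 1 / 2) k) * (
        (poch (2 * n + 1) k / (k.factorial : ℂ)) *
        (poch (c / 2) k / poch (2 * n + 3 / 2 - c / 2) k *
        (poch (c / 2 + 1 / 2) k / poch (2 * n + 2 - c / 2) k)) *
        (poch (d / 2) k / poch (2 * n + 3 / 2 - d / 2) k *
        (poch (d / 2 + 1 / 2) k / poch (2 * n + 2 - d / 2) k))) := by
    simp only [hypTerm_eq_poch, upperR, lowerR, List.map_cons, List.map_nil, List.prod_cons,
      List.prod_nil, one_pow]
    simp only [div_eq_mul_inv, mul_inv, mul_one, one_mul]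
    ring
  rw [e2, hq, dup, dup, alphaR, if_pos (even_two_mul k), Nat.mul_div_cancel_left k two_pos]
  ring

lemma hypTerm_R {c d : ℂ} (h0 : ¬ IsNonposInt (n + 1 / 2))
    (hc : ¬ IsNonposInt (4 * n + 3 - c)) (hd : ¬ IsNonposInt (4 * n + 3 - d)) (k : ℕ) :
    hypTerm (upperR n c d) (lowerR n c d) 1 k =
      Complex.Gamma (4 * n + 3 - c) * Complex.Gamma (4 * n + 3 - d) / (2 * n + 1) *
        (alphaR n (2 * k) * (poised (1 + 2 * (2 * n + 1)) c (2 * k) *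
          poised (1 + 2 * (2 * n + 1)) d (2 * k))) := by
  rw [hypTerm_R_eq_ratio c d h0, show 1 + 2 * (2 * n + 1) = 4 * n + 3 by ring, poised_eq hc,
    poised_eq hd]
  have g1 := Gamma_ne_zero_of_not_isNonposInt hc
  have g2 := Gamma_ne_zero_of_not_isNonposInt hd
  generalize Complex.Gamma (4 * n + 3 - c) = G1 at g1 ⊢
  generalize Complex.Gamma (4 * n + 3 - d) = G2 at g2 ⊢
  generalize poch c (2 * k) / poch (4 * n + 3 - c) (2 * k) = u1
  generalize poch d (2 * k) / poch (4 * n + 3 - d) (2 * k) = u2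
  field_simp

lemma not_isNonposInt_of_half {x : ℂ} (h1 : ¬ IsNonposInt (x / 2))
    (h2 : ¬ IsNonposInt (x / 2 + 1 / 2)) : ¬ IsNonposInt x := by
  rintro ⟨m, hm⟩
  rcases Nat.even_or_odd' m with ⟨j, rfl | rfl⟩
  · exact h1 ⟨j, by push_cast at hm; linear_combination hm / 2⟩
  · exact h2 ⟨j, by push_cast at hm; linear_combination hm / 2⟩

/-- The transformation, with unconditional convergence of the series at `1`. -/
theorem hypergeometric_transformation (n c d : ℂ)
    (hL : ∀ b ∈ lowerL n c d, ¬ IsNonposInt b) (hR : ∀ b ∈ lowerR n c d, ¬ IsNonposInt b)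
    (hcd : ¬ IsNonposInt (4 * n + 3 - c - d))
    (h : (0 < (5 * n + 4 - 2 * c - 2 * d).re ∧ 0 < (3 * n + 2 - c - d).re) ∨
      IsNonposInt c ∨ IsNonposInt d) :
    ∃ s : ℂ, HasSum (hypTerm (upperR n c d) (lowerR n c d) 1) s ∧
      HasHypSum (upperL n c d) (lowerL n c d) (-1)
        (Complex.Gamma (4 * n + 3) * Complex.Gamma (3 * n + 2 - c) *
            Complex.Gamma (3 * n + 2 - d) * Complex.Gamma (4 * n + 3 - c - d) /
          (Complex.Gamma (3 * n + 2) * Complex.Gamma (4 * n + 3 - c) *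
            Complex.Gamma (4 * n + 3 - d) * Complex.Gamma (3 * n + 2 - c - d)) * s) := by
  simp only [lowerL, List.forall_mem_cons, List.not_mem_nil, false_imp_iff, implies_true,
    and_true] at hL
  simp only [lowerR, List.forall_mem_cons, List.not_mem_nil, false_imp_iff, implies_true,
    and_true] at hR
  obtain ⟨l0, l1, l2, l3, l4⟩ := hL
  obtain ⟨r0, r1, r2, r3, r4⟩ := hR
  have hc : ¬ IsNonposInt (4 * n + 3 - c) := not_isNonposInt_of_half
    (by rwa [show (4 * n + 3 - c) / 2 = 2 * n + 3 / 2 - c / 2 by ring])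
    (by rwa [show (4 * n + 3 - c) / 2 + 1 / 2 = 2 * n + 2 - c / 2 by ring])
  have hd : ¬ IsNonposInt (4 * n + 3 - d) := not_isNonposInt_of_half
    (by rwa [show (4 * n + 3 - d) / 2 = 2 * n + 3 / 2 - d / 2 by ring])
    (by rwa [show (4 * n + 3 - d) / 2 + 1 / 2 = 2 * n + 2 - d / 2 by ring])
  have he : ¬ IsNonposInt (4 * n + 3) := by
    refine not_isNonposInt_of_half (by rwa [show (4 * n + 3) / 2 = 2 * n + 3 / 2 by ring]) ?_
    rintro ⟨m, hm⟩
    exact l2 ⟨m + 1, by push_cast; linear_combination hm⟩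
  have a1 : 3 * n + 1 ≠ 0 := fun h => l0 ⟨0, by push_cast; linear_combination h / 2⟩
  have a2 : 2 * n + 1 ≠ 0 := fun h => l2 ⟨0, by simpa using h⟩
  obtain ⟨M, hM1, hM2⟩ := exists_common_sum (c := c) (d := d) l2 l1 h
  have odd0 : ∀ r ∉ Set.range (fun k : ℕ => 2 * k), alphaR n r *
      (poised (1 + 2 * (2 * n + 1)) c r * poised (1 + 2 * (2 * n + 1)) d r) = 0 := by
    intro r hr
    rw [alphaR, if_neg, zero_mul]
    intro hev
    obtain ⟨k, rfl⟩ := hev.two_dvd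
    exact hr ⟨k, rfl⟩
  have hM3 := ((mul_right_injective₀ (two_ne_zero (α := ℕ))).hasSum_iff odd0).mpr hM1
  have hM4 := hM3.mul_left
    (Complex.Gamma (4 * n + 3 - c) * Complex.Gamma (4 * n + 3 - d) / (2 * n + 1))
  have hM5 := hM2.const_mul
    (Complex.Gamma (3 * n + 2 - c) * Complex.Gamma (3 * n + 2 - d) / (3 * n + 1))
  simp only [Function.comp_def, ← hypTerm_R r0 hc hd] at hM4
  refine ⟨_, hM4, ?_⟩
  · simp only [HasHypSum, hypTerm_L l0 l3 l4, ← Finset.mul_sum]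
    convert hM5 using 2
    rw [show 1 + 2 * (2 * n + 1) = 4 * n + 3 by ring, show 1 + (3 * n + 1) = 3 * n + 2 by ring]
    have g1 := Gamma_ne_zero_of_not_isNonposInt hc
    have g2 := Gamma_ne_zero_of_not_isNonposInt hd
    have g3 := Gamma_ne_zero_of_not_isNonposInt he
    have g4 := Gamma_ne_zero_of_not_isNonposInt hcd
    simp only [div_eq_mul_inv, mul_inv]
    -- These two Gamma functions may have poles. There `Complex.Gamma` is `0`, so the inverse is
    -- `0`, the intended value of `1/Γ`; neither has to be cancelled.
    generalize (Complex.Gamma (3 * n + 2))⁻¹ = y1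
    generalize (Complex.Gamma (3 * n + 2 - c - d))⁻¹ = y2
    generalize 2 * n + 1 = x at a2 ⊢
    generalize 3 * n + 1 = y at a1 ⊢
    field_simp

end

/-! ### The two families for Catalan's constant -/

lemma poch_mul_poch_comm (x : ℂ) (m k : ℕ) :
    poch x m * poch (x + m) k = poch x k * poch (x + k) m := by
  rw [← poch_add, ← poch_add, add_comm]

lemma not_isNonposInt_of_re_pos {x : ℂ} (h : 0 < x.re) : ¬ IsNonposInt x := by
  rintro ⟨m, rfl⟩
  have : (0 : ℝ) ≤ m := Nat.cast_nonneg m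
  simp at h
  linarith

lemma poch_ne_zero_of_re_pos {x : ℂ} (h : 0 < x.re) (k : ℕ) : poch x k ≠ 0 :=
  poch_ne_zero (not_isNonposInt_of_re_pos h) k

/-- Turns a product of fixed length with a moving start into a constant times a hypergeometric
quotient in `k`. -/
lemma poch_add_natCast_eq {x : ℂ} (hx : 0 < x.re) (m k : ℕ) :
    poch (x + k) m = poch x m * (poch (x + m) k / poch x k) := by
  have := poch_ne_zero_of_re_pos hx k
  have := poch_mul_poch_comm x m k
  field_simp
  linear_combination -this

lemma Gamma_add_natCast {z : ℂ} (hz : 0 < z.re) (m : ℕ) :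
    Complex.Gamma (z + m) = poch z m * Complex.Gamma z := by
  have h := inv_Gamma_eq_poch_mul z m
  have h1 : Complex.Gamma z ≠ 0 := Complex.Gamma_ne_zero_of_re_pos hz
  have h2 : Complex.Gamma (z + m) ≠ 0 := Complex.Gamma_ne_zero_of_re_pos (by
    rw [Complex.add_re, Complex.natCast_re]; positivity)
  generalize Complex.Gamma (z + m) = G at *
  field_simp at h
  rw [h, mul_comm]

lemma factorial_two_mul (m : ℕ) :
    ((2 * m).factorial : ℂ) = 4 ^ m * (poch (1 / 2) m * m.factorial) := by
  rw [← poch_one, poch_two_mul, ← poch_one]; norm_num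

lemma ofReal_catTerm_add (n k : ℕ) : ((catTerm n (n + k) : ℝ) : ℂ) =
    (3 * n + 1) * (n.factorial ^ 2 * poch (2 * n + 1) n) / poch (n + 1 / 2) (n + 1) ^ 3 *
      hypTerm (upperL n (n + 1 / 2) (n + 1 / 2)) (lowerL n (n + 1 / 2) (n + 1 / 2)) (-1) k := by
  have hn : (0 : ℝ) ≤ n := Nat.cast_nonneg n
  have icc : ∀ f : ℕ → ℂ, ∏ j ∈ Finset.Icc 1 n, f j = ∏ j ∈ Finset.range n, f (1 + j) := fun f => by
    rw [← Finset.Ico_add_one_right_eq_Icc, Finset.prod_Ico_eq_prod_range]; simp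
  have p1 : ∏ j ∈ Finset.Icc 1 n, (((n + k : ℕ) : ℂ) + 1 - j) = poch (1 + k) n := by
    -- The factors descend in `j`; reversing their order gives a rising product from `k + 1`.
    rw [icc, ← prod_range_add_eq_poch, ← Finset.prod_range_reflect]
    refine Finset.prod_congr rfl fun j hj => ?_
    have hj' : j + 1 ≤ n := Finset.mem_range.mp hj
    rw [show n - 1 - j = n - (j + 1) by omega, Nat.cast_add 1, Nat.cast_sub hj']
    push_cast; ring
  have p2 : ∏ j ∈ Finset.Icc 1 n, (((n + k : ℕ) : ℂ) + n + j) = poch (2 * n + 1 + k) n := by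
    rw [icc, ← prod_range_add_eq_poch]
    refine Finset.prod_congr rfl fun j _ => ?_
    push_cast; ring
  have p3 : ∏ j ∈ Finset.range (n + 1), (((n + k : ℕ) : ℂ) + j + 1 / 2) =
      poch (n + 1 / 2 + k) (n + 1) := by
    rw [← prod_range_add_eq_poch]
    refine Finset.prod_congr rfl fun j _ => ?_
    push_cast; ring
  have q1 := poch_add_natCast_eq (x := 1) (by simp) n k
  have q2 := poch_add_natCast_eq (x := 2 * n + 1) (by simp; positivity) n k
  have q3 := poch_add_natCast_eq (x := n + 1 / 2) (by simp; positivity) (n + 1) k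
  rw [poch_one, poch_one] at q1
  rw [show (2 * n + 1 + n : ℂ) = 3 * n + 1 by ring] at q2
  rw [show (n + 1 / 2 + (n + 1 : ℕ) : ℂ) = 2 * n + 3 / 2 by push_cast; ring] at q3
  have hcast : ((catTerm n (n + k) : ℝ) : ℂ) = (2 * (n + k : ℕ) + n + 1) *
    ((n.factorial * (∏ j ∈ Finset.Icc 1 n, (((n + k : ℕ) : ℂ) + 1 - j)) *
        ∏ j ∈ Finset.Icc 1 n, (((n + k : ℕ) : ℂ) + n + j)) /
      (∏ j ∈ Finset.range (n + 1), (((n + k : ℕ) : ℂ) + j + 1 / 2)) ^ 3) *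
      (-1) ^ (n + (n + k)) := by
    rw [catTerm, Finset.prod_pow]; push_cast; rfl
  rw [hcast, p1, p2, p3, q1, q2, q3, hypTerm_L_eq_ratio _ _ (not_isNonposInt_of_re_pos (by
    simp; positivity)), alphaL, show (3 * n + 2 - (n + 1 / 2) : ℂ) = 2 * n + 3 / 2 by ring]
  have h1 : (3 * n + 1 : ℂ) ≠ 0 := by norm_cast
  have h2 : poch (n + 1 / 2) k ≠ 0 := poch_ne_zero_of_re_pos (by simp; positivity) k
  have h3 : poch (2 * n + 3 / 2) k ≠ 0 := poch_ne_zero_of_re_pos (by simp; positivity) k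
  have h4 : poch (2 * n + 1) k ≠ 0 := poch_ne_zero_of_re_pos (by simp; positivity) k
  have h5 : poch (n + 1 / 2) (n + 1) ≠ 0 := poch_ne_zero_of_re_pos (by simp; positivity) _
  have s1 : (-1 : ℂ) ^ (n + (n + k)) = (-1) ^ k := by
    rw [← add_assoc, pow_add, Even.neg_one_pow ⟨n, rfl⟩, one_mul]
  rw [s1, add_comm (1 : ℂ) (n : ℂ)]
  push_cast
  rw [show 2 * ((n : ℂ) + k) + n + 1 = 3 * n + 1 + 2 * k by ring]
  generalize (3 * n + 1 : ℂ) = x5 at *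
  generalize poch (n + 1 / 2) k = x1 at *
  generalize poch (2 * n + 3 / 2) k = x2 at *
  generalize poch (2 * n + 1) k = x3 at *
  generalize poch (n + 1 / 2) (n + 1) = x4 at *
  have f : (k.factorial : ℂ) ≠ 0 := by exact_mod_cast k.factorial_ne_zero
  field_simp

lemma catTerm_eq_zero {n t : ℕ} (h : t < n) : catTerm n t = 0 := by
  have : ∏ j ∈ Finset.Icc 1 n, ((t : ℝ) + 1 - j) = 0 :=
    Finset.prod_eq_zero (i := t + 1) (by simp; omega) (by push_cast; ring)
  rw [catTerm, this]; simp

lemma ofReal_catTerm'_add (n k : ℕ) : ((catTerm' n (n + k + 1) : ℝ) : ℂ) =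
    4 ^ (n + 1) * (2 * n + 1) * ((2 * n + 1).factorial * (2 * n).factorial) /
      poch (n + 1 / 2) (2 * n + 2) ^ 2 *
      hypTerm (upperR n (n + 1 / 2) (n + 1 / 2)) (lowerR n (n + 1 / 2) (n + 1 / 2)) 1 k := by
  have hn : (0 : ℝ) ≤ n := Nat.cast_nonneg n
  have p1 : ∏ j ∈ Finset.range (2 * n), (((n + k + 1 : ℕ) : ℂ) - n + j) = poch (1 + k) (2 * n) := by
    rw [← prod_range_add_eq_poch]
    refine Finset.prod_congr rfl fun j _ => ?_
    push_cast; ring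
  have p2 : ∏ j ∈ Finset.range (2 * n + 2), (2 * ((n + k + 1 : ℕ) : ℂ) - n - 3 / 2 + j) =
      poch (n + 1 / 2 + (2 * k : ℕ)) (2 * n + 2) := by
    rw [← prod_range_add_eq_poch]
    refine Finset.prod_congr rfl fun j _ => ?_
    push_cast; ring
  have q1 := poch_add_natCast_eq (x := 1) (by simp) (2 * n) k
  have q2 := poch_add_natCast_eq (x := n + 1 / 2) (by simp; positivity) (2 * n + 2) (2 * k)
  rw [poch_one, poch_one, show (1 + (2 * n : ℕ) : ℂ) = 2 * n + 1 by push_cast; ring] at q1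
  rw [show (n + 1 / 2 + (2 * n + 2 : ℕ) : ℂ) = 3 * n + 5 / 2 by push_cast; ring] at q2
  have hcast : ((catTerm' n (n + k + 1) : ℝ) : ℂ) = 2 ^ (2 * (n + 1)) *
    ((2 * (n + k + 1 : ℕ) - 1) *
      (((2 * n + 1).factorial * ∏ j ∈ Finset.range (2 * n), (((n + k + 1 : ℕ) : ℂ) - n + j)) /
        (∏ j ∈ Finset.range (2 * n + 2), (2 * ((n + k + 1 : ℕ) : ℂ) - n - 3 / 2 + j)) ^ 2)) := by
    rw [catTerm', Finset.prod_pow]; push_cast; rfl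
  rw [hcast, p1, p2, q1, q2, hypTerm_R_eq_ratio _ _ (not_isNonposInt_of_re_pos (by
    simp; positivity)), alphaR, if_pos (even_two_mul k), Nat.mul_div_cancel_left k two_pos,
    show (4 * n + 3 - (n + 1 / 2) : ℂ) = 3 * n + 5 / 2 by ring, pow_mul,
    show (2 : ℂ) ^ 2 = 4 by norm_num]
  have h1 : (2 * n + 1 : ℂ) ≠ 0 := by norm_cast
  have h2 : poch (n + 1 / 2) (2 * k) ≠ 0 := poch_ne_zero_of_re_pos (by simp; positivity) _
  have h3 : poch (3 * n + 5 / 2) (2 * k) ≠ 0 := poch_ne_zero_of_re_pos (by simp; positivity) _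
  have h5 : poch (n + 1 / 2) (2 * n + 2) ≠ 0 := poch_ne_zero_of_re_pos (by simp; positivity) _
  push_cast
  generalize poch (n + 1 / 2) (2 * k) = x1 at *
  generalize poch (3 * n + 5 / 2) (2 * k) = x2 at *
  generalize poch (n + 1 / 2) (2 * n + 2) = x4 at *
  have f : (k.factorial : ℂ) ≠ 0 := by exact_mod_cast k.factorial_ne_zero
  field_simp
  ring

lemma catTerm'_eq_zero {n t : ℕ} (h : t < n) : catTerm' n (t + 1) = 0 := by
  have : ∏ j ∈ Finset.range (2 * n), (((t + 1 : ℕ) : ℝ) - n + j) = 0 :=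
    Finset.prod_eq_zero (i := n - (t + 1)) (by simp; omega)
      (by rw [Nat.cast_sub (by omega : t + 1 ≤ n)]; ring)
  rw [catTerm', this]; simp

/-- Each Gamma value is a factorial or a Pochhammer multiple of `Γ(n + 1/2)`, whose squares cancel.
What remains is the duplication identity `k2`. -/
lemma catalan_constants (n : ℕ) :
    (3 * n + 1) * (n.factorial ^ 2 * poch (2 * n + 1) n) / poch (n + 1 / 2) (n + 1) ^ 3 *
      (Complex.Gamma (4 * n + 3) * Complex.Gamma (3 * n + 2 - (n + 1 / 2)) *
            Complex.Gamma (3 * n + 2 - (n + 1 / 2)) *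
            Complex.Gamma (4 * n + 3 - (n + 1 / 2) - (n + 1 / 2)) /
          (Complex.Gamma (3 * n + 2) * Complex.Gamma (4 * n + 3 - (n + 1 / 2)) *
            Complex.Gamma (4 * n + 3 - (n + 1 / 2)) *
            Complex.Gamma (3 * n + 2 - (n + 1 / 2) - (n + 1 / 2)))) =
    4 ^ (n + 1) * (2 * n + 1) * ((2 * n + 1).factorial * (2 * n).factorial) /
      poch (n + 1 / 2) (2 * n + 2) ^ 2 := by
  have g1 : Complex.Gamma (4 * n + 3) = (4 * n + 2).factorial := by
    rw [← Complex.Gamma_nat_eq_factorial]; congr 1; push_cast; ring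
  have g2 : Complex.Gamma (4 * n + 3 - (n + 1 / 2) - (n + 1 / 2)) = (2 * n + 1).factorial := by
    rw [← Complex.Gamma_nat_eq_factorial]; congr 1; push_cast; ring
  have g3 : Complex.Gamma (3 * n + 2) = (3 * n + 1).factorial := by
    rw [← Complex.Gamma_nat_eq_factorial]; congr 1; push_cast; ring
  have g4 : Complex.Gamma (3 * n + 2 - (n + 1 / 2) - (n + 1 / 2)) = n.factorial := by
    rw [← Complex.Gamma_nat_eq_factorial]; congr 1; ring
  have hre : 0 < (n + 1 / 2 : ℂ).re := by simp; positivity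
  have hG : Complex.Gamma (n + 1 / 2) ≠ 0 := Complex.Gamma_ne_zero_of_re_pos hre
  have gen : ∀ m : ℕ, Complex.Gamma (n + 1 / 2 + m) =
      poch (n + 1 / 2) m * Complex.Gamma (n + 1 / 2) := fun m =>
    Gamma_add_natCast hre m
  have g5 : Complex.Gamma (3 * n + 2 - (n + 1 / 2)) =
      poch (n + 1 / 2) (n + 1) * Complex.Gamma (n + 1 / 2) := by
    rw [← gen]; congr 1; push_cast; ring
  have g6 : Complex.Gamma (4 * n + 3 - (n + 1 / 2)) =
      poch (n + 1 / 2) (2 * n + 2) * Complex.Gamma (n + 1 / 2) := by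
    rw [← gen]; congr 1; push_cast; ring
  have k1 : ((2 * n).factorial : ℂ) * poch (2 * n + 1) n = (3 * n).factorial := by
    rw [← poch_one, ← poch_one, show 3 * n = 2 * n + n by ring, poch_add]; push_cast; ring_nf
  have k2 : ((4 * n + 2).factorial : ℂ) * n.factorial =
      4 ^ (n + 1) * (2 * n + 1) * (2 * n).factorial ^ 2 * poch (n + 1 / 2) (n + 1) := by
    have e1 := factorial_two_mul (2 * n + 1)
    have e2 := factorial_two_mul n
    have e3 : poch (1 / 2) (2 * n + 1) = poch (1 / 2) n * poch (n + 1 / 2) (n + 1) := by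
      rw [show 2 * n + 1 = n + (n + 1) by ring, poch_add, add_comm (1 / 2 : ℂ)]
    rw [show 4 * n + 2 = 2 * (2 * n + 1) by ring, e1, e3, Nat.factorial_succ (2 * n), sq,
      show 2 * n + 1 = n + 1 + n by ring, pow_add]
    nth_rewrite 2 [e2]
    push_cast
    ring
  have f1 : (n.factorial : ℂ) ≠ 0 := by exact_mod_cast n.factorial_ne_zero
  have f2 : ((2 * n).factorial : ℂ) ≠ 0 := by exact_mod_cast (2 * n).factorial_ne_zero
  have f3 : ((3 * n).factorial : ℂ) ≠ 0 := by exact_mod_cast (3 * n).factorial_ne_zero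
  have f4 : (3 * n + 1 : ℂ) ≠ 0 := by norm_cast
  have f5 : ((3 * n + 1).factorial : ℂ) = (3 * n + 1) * (3 * n).factorial := by
    rw [Nat.factorial_succ]; push_cast; ring
  have h1 : poch (n + 1 / 2) (n + 1) ≠ 0 := poch_ne_zero_of_re_pos hre _
  have h2 : poch (n + 1 / 2) (2 * n + 2) ≠ 0 := poch_ne_zero_of_re_pos hre _
  have k1' : poch (2 * n + 1) n = (3 * n).factorial / (2 * n).factorial := by
    rw [← k1]; field_simp
  have k2' : ((4 * n + 2).factorial : ℂ) =
      4 ^ (n + 1) * (2 * n + 1) * (2 * n).factorial ^ 2 * poch (n + 1 / 2) (n + 1) /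
        n.factorial := by
    rw [← k2]; field_simp
  rw [g1, g2, g3, g4, g5, g6, k1', k2', f5]
  generalize poch (n + 1 / 2) (n + 1) = y1 at *
  generalize poch (n + 1 / 2) (2 * n + 2) = y2 at *
  generalize Complex.Gamma (n + 1 / 2) = y3 at *
  generalize (4 : ℂ) ^ (n + 1) = y4
  generalize (3 * n + 1 : ℂ) = y5 at *
  field_simp

/-- The two families of approximations to Catalan's constant coincide. -/
theorem catalan_families (n : ℕ) : ∃ r : ℝ,
    HasSum (fun t : ℕ => catTerm n t) r ∧ HasSum (fun t : ℕ => catTerm' n (t + 1)) r := by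
  have hn : (0 : ℝ) ≤ n := Nat.cast_nonneg n
  set c : ℂ := n + 1 / 2 with hcdef
  have hcre : c.re = n + 1 / 2 := by simp [hcdef]
  have hL : ∀ b ∈ lowerL n c c, ¬ IsNonposInt b := by
    intro b hb
    apply not_isNonposInt_of_re_pos
    simp only [lowerL, List.mem_cons, List.not_mem_nil, or_false] at hb
    rcases hb with rfl | rfl | rfl | rfl | rfl <;> simp [hcre] <;> linarith
  have hR : ∀ b ∈ lowerR n c c, ¬ IsNonposInt b := by
    intro b hb
    apply not_isNonposInt_of_re_pos
    simp only [lowerR, List.mem_cons, List.not_mem_nil, or_false] at hb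
    rcases hb with rfl | rfl | rfl | rfl | rfl <;> simp [hcre] <;> linarith
  obtain ⟨s, hs1, hs2⟩ := hypergeometric_transformation n c c hL hR
    (not_isNonposInt_of_re_pos (by simp [hcre]; linarith))
    (Or.inl ⟨by simp [hcre]; linarith, by simp [hcre]; linarith⟩)
  -- `HasSum` requires absolute convergence, which holds here: the terms are `O(k^(-n-2))`.
  have hsumL : Summable (hypTerm (upperL n c c) (lowerL n c c) (-1)) := by
    have l1 : ¬ IsNonposInt (2 * (n : ℂ) + 1) := hL _ (by simp [lowerL])
    have l2 : ¬ IsNonposInt (2 * (n : ℂ) + 3 / 2) := hL _ (by simp [lowerL])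
    have hα : PolyBdd Set.univ (n : ℂ).re fun _ r => (-1) ^ r * alphaL n r := by
      obtain ⟨C, hC⟩ := (polyReg_alphaL l1 l2).1
      exact ⟨C, fun c hc k => by simpa using hC c hc k⟩
    have h := summable_mul_poised hα (e := 1 + (3 * n + 1)) (c := c) (d := c)
      (by simp [hcre]; linarith)
    have hterm := hypTerm_L (n := n) (c := c) (d := c) (hL _ (by simp [lowerL]))
      (hL _ (by simp [lowerL])) (hL _ (by simp [lowerL]))
    rw [funext hterm]
    exact h.mul_left _
  have hL2 := hsumL.hasSum
  rw [tendsto_nhds_unique hL2.tendsto_sum_nat hs2] at hL2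
  have hL3 := hL2.mul_left
    ((3 * n + 1) * (n.factorial ^ 2 * poch (2 * n + 1) n) / poch (n + 1 / 2) (n + 1) ^ 3)
  rw [hcdef, ← mul_assoc _ _ s, catalan_constants] at hL3
  have hR3 := hs1.mul_left (4 ^ (n + 1) * (2 * n + 1) *
    ((2 * n + 1).factorial * (2 * n).factorial) / poch (n + 1 / 2) (2 * n + 2) ^ 2)
  rw [hcdef] at hR3
  simp only [← ofReal_catTerm_add] at hL3
  simp only [← ofReal_catTerm'_add] at hR3
  -- The first `n` terms of each family vanish, so the sums reindexed from `n` are the full ones.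
  have shift : ∀ (f : ℕ → ℝ) (z : ℂ), (∀ t < n, f t = 0) →
      HasSum (fun k => ((f (n + k) : ℝ) : ℂ)) z → HasSum f z.re := by
    intro f z hf hz
    have hz' := Complex.hasSum_re hz
    simp only [Complex.ofReal_re] at hz'
    refine ((add_right_injective n).hasSum_iff (f := f) fun t ht => hf t ?_).mp hz'
    by_contra hlt
    exact ht ⟨t - n, by simp; omega⟩
  exact ⟨_, shift _ _ (fun t ht => catTerm_eq_zero ht) hL3,
    shift (fun t => catTerm' n (t + 1)) _ (fun t ht => catTerm'_eq_zero ht) hR3⟩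

theorem mainTheorem2 :
    (∀ n c d : ℂ,
      -- the lower parameters of both series are admissible, and so is `Γ(4n+3-c-d)`
      (∀ b ∈ lowerL n c d, ¬ IsNonposInt b) →
      (∀ b ∈ lowerR n c d, ¬ IsNonposInt b) →
      ¬ IsNonposInt (4 * n + 3 - c - d) →
      -- both series converge at the points `-1` and `1` of the unit circle, or both terminate
      ((0 < (5 * n + 4 - 2 * c - 2 * d).re ∧ 0 < (3 * n + 2 - c - d).re) ∨
        IsNonposInt c ∨ IsNonposInt d) →
      ∃ s : ℂ, HasHypSum (upperR n c d) (lowerR n c d) 1 s ∧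
        HasHypSum (upperL n c d) (lowerL n c d) (-1)
          (Complex.Gamma (4 * n + 3) * Complex.Gamma (3 * n + 2 - c) *
              Complex.Gamma (3 * n + 2 - d) * Complex.Gamma (4 * n + 3 - c - d) /
            (Complex.Gamma (3 * n + 2) * Complex.Gamma (4 * n + 3 - c) *
              Complex.Gamma (4 * n + 3 - d) * Complex.Gamma (3 * n + 2 - c - d)) * s)) ∧
    (∀ n : ℕ, ∃ r : ℝ,
      HasSum (fun t : ℕ => catTerm n t) r ∧ HasSum (fun t : ℕ => catTerm' n (t + 1)) r) := by
  refine ⟨fun n c d hL hR hcd h => ?_, catalan_families⟩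
  obtain ⟨s, h1, h2⟩ := hypergeometric_transformation n c d hL hR hcd h
  exact ⟨s, h1.tendsto_sum_nat, h2⟩
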